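/- Let $K$ be a field, $n\ge 0$ an integer, $A=(a_{i,j})_{1\le i,j\le n}$ an $n\times n$ matrix over $K$, and $\lambda=(\lambda_a)_{a\in\mathbb Z}$, $\mu=(\mu_a)_{a\in\mathbb Z}$ sequences in $K$. The generalized Lambda-determinant of $A$ is $|A|_{\lambda,\mu}=T_{0,0,n}$, where $T_{i,j,k}$ ($i+j+k\equiv n \bmod 2$, $k\ge 0$, $|i|+|j|+k\le n$) is the solution of $$T_{i,j,k+1}T_{i,j,k-1}=\mu_j\,T_{i,j+1,k}T_{i,j-1,k}+\lambda_i\,T_{i+1,j,k}T_{i-1,j,k},\qquad T_{i,j,0}=1,\quad T_{i,j,1}=a_{\frac{j-i+n+1}{2},\frac{i+j+n+1}{2}} .$$ Assume that this definition makes sense, i.e. that every $T_{i,j,k}$ with $|i|+|j|+k\le n-2$ and $i+j+k\equiv n \bmod 2$ is nonzero (these are the quantities by which the recursion divides), and that the matrix entries occurring as denominators in the network below, $a_{i,j}$ with $2\le i\le n$, are nonzero. Let $\hat G_{min}(n)$ be the following weighted directed network. Its vertices are the points $(x,y)\in\mathbb Z^2$ with $x+y$ even and $|x|+|y-n+1|\le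 n-1$. Put $\alpha_{x,y}=a_{\frac{x-y}{2}+n,\frac{x+y}{2}+1}$. Whenever both end points are vertices, there are * an up edge $(x,y)\to(x+1,y+1)$ of weight $\lambda_{y+1-n}$, provided that $x<y$; * a horizontal edge $(x,y)\to(x+2,y)$ of weight $\mu_{x+1}\,\alpha_{x,y}/\alpha_{x+1,y-1}$; * a down edge $(x,y)\to(x+1,y-1)$ of weight $\alpha_{x,y}/\alpha_{x+1,y-1}$, provided that $-x<y$. The weight of a directed path is the product of the weights of its edges (and $1$ for a path consisting of one vertex). For $1\le i\le 2n-1$ the $i$-th entry (exit) vertex is the leftmost (rightmost) vertex at height $y=i-1$; for $i\le n$ these are the SW vertices $(1-i,i-1)$ and the SE vertices $(i-1,i-1)$. Let $\hat\Theta_{min}(n)$ be the $(2n-1)\times(2n-1)$ matrix whose $(i,j)$ entry is the sum of the weights of all directed paths from the $i$-th entry vertex to the $j$-th exit vertex, and let $\hat a_{min}(n)$ be its principal minor on the first $n$ rows and columns. (For $n=0$ the network and the matrices are empty and the minor is $1$.) Then $$|A|_{\lambda,\mu}=\hat a_{min}(n)\prod_{j=1}^n a_{n,j},$$ and also $$|A|_{\lambda,\mu}=\hat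 Z_n\prod_{j=1}^n a_{n,j},$$ where $\hat Z_n$ is the partition function of the families of $n$ non-intersecting (pairwise vertex-disjoint) directed paths on $\hat G_{min}(n)$ starting at the $n$ SW vertices, one from each, and ending at SE vertices: the sum over all such families of the product of the weights of the $n$ paths. -/

import Mathlib

noncomputable section

namespace LambdaDet

variable {K : Type*} [Field K] {n : ℕ}

/-- The entry `a_{r,c}` of `A`, with the rows and columns numbered `1, …, n` by integers
(and `0` outside of this range, where it is never used below). -/
def entry (A : Matrix (Fin n) (Fin n) K) (r c : ℤ) : K :=
  if h : (1 ≤ r ∧ r ≤ n) ∧ (1 ≤ c ∧ c ≤ n) then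
    A ⟨(r - 1).toNat, by omega⟩ ⟨(c - 1).toNat, by omega⟩
  else 0

/-- `T A lam mu k i j` is the solution `T_{i,j,k}` of the inhomogeneous `T`-system
`T_{i,j,k+1} T_{i,j,k-1} = μ_j T_{i,j+1,k} T_{i,j-1,k} + λ_i T_{i+1,j,k} T_{i-1,j,k}`
with initial data `T_{i,j,0} = 1` and `T_{i,j,1} = a_{(j-i+n+1)/2, (i+j+n+1)/2}`.
Only the values with `i + j + k ≡ n` modulo `2` and `|i| + |j| + k ≤ n` are meaningful. -/
def T (A : Matrix (Fin n) (Fin n) K) (lam mu : ℤ → K) : ℕ → ℤ → ℤ → K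
  | 0, _, _ => 1
  | 1, i, j => entry A ((j - i + n + 1) / 2) ((i + j + n + 1) / 2)
  | k + 2, i, j =>
      (mu j * T A lam mu (k + 1) i (j + 1) * T A lam mu (k + 1) i (j - 1)
        + lam i * T A lam mu (k + 1) (i + 1) j * T A lam mu (k + 1) (i - 1) j)
      / T A lam mu k i j

/-- The generalized Lambda-determinant `|A|_{λ,μ} = T_{0,0,n}`. -/
def lambdaDet (A : Matrix (Fin n) (Fin n) K) (lam mu : ℤ → K) : K :=
  T A lam mu n 0 0

/-- The definition of `|A|_{λ,μ}` makes sense: every `T_{i,j,k}` by which one divides in the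
computation of `T_{0,0,n}` is nonzero. -/
def IsDefined (A : Matrix (Fin n) (Fin n) K) (lam mu : ℤ → K) : Prop :=
  ∀ (k : ℕ) (i j : ℤ), (i + j + k) % 2 = (n : ℤ) % 2 → |i| + |j| + k + 2 ≤ n →
    T A lam mu k i j ≠ 0

/-- The vertices of the network: the points `(x, y)` of the diamond
`|x| + |y - n + 1| ≤ n - 1` with `x + y` even. -/
def InDiamond (n : ℕ) (p : ℤ × ℤ) : Prop :=
  (p.1 + p.2) % 2 = 0 ∧ |p.1| + |p.2 - n + 1| ≤ (n : ℤ) - 1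

/-- The label `a_{(x-y)/2+n, (x+y)/2+1}` of the down-pointing triangle with bottom
vertex `(x, y)`. -/
def label (A : Matrix (Fin n) (Fin n) K) (p : ℤ × ℤ) : K :=
  entry A ((p.1 - p.2) / 2 + n) ((p.1 + p.2) / 2 + 1)

/-- The directed edges of the network `Ĝ_min(n)`: up, horizontal and down edges of the triangular
lattice, from left to right. The concatenation of chips that defines the network
has no down edge along the SW border `x = -y` and no up edge along the SE border `x = y`; in
particular the bottom vertex `(0, 0)` is isolated. -/
def Edge (n : ℕ) (u v : ℤ × ℤ) : Prop :=
  InDiamond n u ∧ InDiamond n v ∧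
    ((v = (u.1 + 1, u.2 + 1) ∧ u.1 < u.2) ∨
      v = (u.1 + 2, u.2) ∨
      (v = (u.1 + 1, u.2 - 1) ∧ -u.1 < u.2))

/-- The weight of the edge from `u = (x, y)` to `v`: it is `λ_{y+1-n}` for an up edge,
`μ_{x+1} α_{x,y} / α_{x+1,y-1}` for a horizontal edge, and `α_{x,y} / α_{x+1,y-1}` for a down
edge, where `α` denotes the label. -/
def edgeWeight (A : Matrix (Fin n) (Fin n) K) (lam mu : ℤ → K) (u v : ℤ × ℤ) : K :=
  if v = (u.1 + 1, u.2 + 1) then lam (u.2 + 1 - n)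
  else if v = (u.1 + 2, u.2) then mu (u.1 + 1) * (label A u / label A (u.1 + 1, u.2 - 1))
  else label A u / label A (u.1 + 1, u.2 - 1)

/-- `l` is the list of successive vertices of a directed path from `u` to `v` (a single vertex is
a path from itself to itself). -/
def IsPath (n : ℕ) (u v : ℤ × ℤ) (l : List (ℤ × ℤ)) : Prop :=
  (∀ p ∈ l, InDiamond n p) ∧ l.IsChain (Edge n) ∧ l.head? = some u ∧ l.getLast? = some v

/-- The directed paths from `u` to `v` on the network. -/
def Path (n : ℕ) (u v : ℤ × ℤ) : Type :=
  {l : List (ℤ × ℤ) // IsPath n u v l}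

/-- The product of the weights of the edges between successive vertices of a list. -/
def listWeight (A : Matrix (Fin n) (Fin n) K) (lam mu : ℤ → K) : List (ℤ × ℤ) → K
  | [] => 1
  | [_] => 1
  | u :: v :: l => edgeWeight A lam mu u v * listWeight A lam mu (v :: l)

theorem finite_inDiamond (n : ℕ) : {p : ℤ × ℤ | InDiamond n p}.Finite := by
  apply (Set.finite_Icc ((-(n : ℤ), -(n : ℤ)) : ℤ × ℤ) ((n : ℤ), 2 * (n : ℤ))).subset
  rintro ⟨x, y⟩ ⟨-, h⟩
  simp only [Set.mem_Icc, Prod.le_def]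
  simp only at h
  have h1 := abs_le.1 (le_refl |x|)
  have h2 := abs_le.1 (le_refl |y - n + 1|)
  omega

theorem IsPath.nodup {u v : ℤ × ℤ} {l : List (ℤ × ℤ)} (h : IsPath n u v l) : l.Nodup := by
  have h1 : l.IsChain (fun a b => a.1 < b.1) := h.2.1.imp (by
    rintro a b ⟨-, -, ⟨rfl, -⟩ | rfl | ⟨rfl, -⟩⟩ <;> simp)
  have : IsTrans (ℤ × ℤ) (fun a b => a.1 < b.1) := ⟨fun a b c => lt_trans⟩
  exact (List.isChain_iff_pairwise.1 h1).imp (fun {a b} hab => by rintro rfl; exact lt_irrefl _ hab)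

instance instFinitePath (u v : ℤ × ℤ) : Finite (Path n u v) := by
  have : Fintype {p : ℤ × ℤ // InDiamond n p} := (finite_inDiamond n).fintype
  let f : Path n u v → {l : List {p : ℤ × ℤ // InDiamond n p} // l.Nodup} := fun l =>
    ⟨l.1.attach.map fun p => ⟨p.1, l.2.1 p.1 p.2⟩, by
      refine (List.nodup_attach.2 l.2.nodup).map ?_
      intro a b hab
      exact Subtype.ext (congrArg (fun q => q.1) hab)⟩
  classical
  refine Finite.of_injective f ?_
  intro a b hab
  have h := congrArg (fun q => q.1.map Subtype.val) hab
  simp only [f, List.map_map, Function.comp_def, List.attach_map_subtype_val] at h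
  exact Subtype.ext h

instance instFintypePath (u v : ℤ × ℤ) : Fintype (Path n u v) := Fintype.ofFinite _

/-- The entry vertex of the network at height `y`, on the left (SW or NW) border;
for `y < n` it is the SW vertex `(-y, y)`. -/
def leftVertex (n : ℕ) (y : ℤ) : ℤ × ℤ := (-((n : ℤ) - 1 - |y - n + 1|), y)

/-- The exit vertex of the network at height `y`, on the right (SE or NE) border;
for `y < n` it is the SE vertex `(y, y)`. -/
def rightVertex (n : ℕ) (y : ℤ) : ℤ × ℤ := ((n : ℤ) - 1 - |y - n + 1|, y)

/-- The matrix `Θ̂_min(n)` of the network, of size `2n - 1`: its entry `(i, j)` is the sum over the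
directed paths from the `i`-th entry vertex to the `j`-th exit vertex (both counted from the bottom)
of the product of the edge weights. -/
def thetaHat (A : Matrix (Fin n) (Fin n) K) (lam mu : ℤ → K) :
    Matrix (Fin (2 * n - 1)) (Fin (2 * n - 1)) K :=
  Matrix.of fun i j =>
    ∑ p : Path n (leftVertex n (i : ℕ)) (rightVertex n (j : ℕ)), listWeight A lam mu p.1

/-- The principal minor `â_min(n)` of `Θ̂_min(n)` on the first `n` rows and columns. -/
def aHat (A : Matrix (Fin n) (Fin n) K) (lam mu : ℤ → K) : K :=
  ((thetaHat A lam mu).submatrix (Fin.castLE (by omega : n ≤ 2 * n - 1))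
    (Fin.castLE (by omega : n ≤ 2 * n - 1))).det

/-- The families of `n` non-intersecting (pairwise vertex-disjoint) directed paths, one from each of
the `n` SW vertices `(-i, i)`, each ending at one of the `n` SE vertices `(j, j)`. -/
def NonIntersecting (n : ℕ) : Type :=
  {f : (i : Fin n) → Σ j : Fin n, Path n (-((i : ℕ) : ℤ), ((i : ℕ) : ℤ)) (((j : ℕ) : ℤ), ((j : ℕ) : ℤ)) //
    ∀ i i' : Fin n, i ≠ i' → List.Disjoint (f i).2.1 (f i').2.1}

instance instFintypeNonIntersecting : Fintype (NonIntersecting n) :=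
  have : Finite (NonIntersecting n) := Subtype.finite
  Fintype.ofFinite _

/-- The partition function of the families of `n` non-intersecting paths. -/
def partitionFunction (A : Matrix (Fin n) (Fin n) K) (lam mu : ℤ → K) : K :=
  ∑ f : NonIntersecting n, ∏ i : Fin n, listWeight A lam mu (f.1 i).2.1

end LambdaDet

end

/-! In the coordinates `u = (x + y) / 2`, `v = (y - x) / 2` the network is a square lattice with
steps `(1, 0)`, `(0, -1)` and `(1, -1)`. Deleting the edges along its two lower borders does not
change the determinant of the path sums, and the resulting matrix is, up to one corner entry, a
triangular matrix times a smaller path matrix times a triangular matrix. By the Desnanot–Jacobi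
identity the determinants of the shifted networks, multiplied by the bottom rows of the
corresponding blocks of `A`, therefore satisfy the `T`-system. Non-intersecting paths keep the order
of their end points, so the Lindström–Gessel–Viennot lemma turns the determinant into the partition
function. -/

noncomputable section

namespace LambdaDet

section Determinants

open Matrix

variable {R : Type*} [CommRing R]

theorem det_mul_det_toBlocks₂₂_adjugate {ι κ : Type*} [Fintype ι] [Fintype κ] [DecidableEq ι]
    [DecidableEq κ] (M : Matrix (ι ⊕ κ) (ι ⊕ κ) R) :
    M.det * M.adjugate.toBlocks₂₂.det = M.toBlocks₁₁.det * M.det ^ Fintype.card κ := by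
  have hblocks : M * fromBlocks 1 M.adjugate.toBlocks₁₂ 0 M.adjugate.toBlocks₂₂ =
      fromBlocks M.toBlocks₁₁ 0 M.toBlocks₂₁ (M.det • 1) := by
    have h := mul_adjugate M
    rw [← fromBlocks_toBlocks M.adjugate] at h
    nth_rw 1 [← fromBlocks_toBlocks M] at h
    nth_rw 1 [← fromBlocks_toBlocks M]
    rw [fromBlocks_multiply, ← fromBlocks_one, fromBlocks_smul, fromBlocks_inj] at h
    simp [fromBlocks_multiply, h.2.1, h.2.2.2]
  simpa using congrArg det hblocks

theorem isRegular_det_charmatrix {ι : Type*} [Fintype ι] [DecidableEq ι] (M : Matrix ι ι R) :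
    IsRegular M.charmatrix.det :=
  M.charpoly_monic.isRegular

theorem map_eval_zero_charmatrix_neg {ι : Type*} [Fintype ι] [DecidableEq ι] (M : Matrix ι ι R) :
    (-M).charmatrix.map (Polynomial.evalRingHom 0) = M := by
  ext i j
  by_cases hij : i = j
  · subst hij; simp
  · simp [charmatrix_apply_ne _ _ _ hij]

/-- `Fin (m + 2)` as the disjoint union of its interior and its two end points, the index
decomposition behind the Desnanot–Jacobi identity. -/
def interiorEndsEquiv (m : ℕ) : Fin m ⊕ Fin 2 ≃ Fin (m + 2) :=
  Equiv.ofBijective (Sum.elim (Fin.castSucc ∘ Fin.succ) ![0, Fin.last (m + 1)]) <| by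
    rw [Fintype.bijective_iff_injective_and_card]
    refine ⟨?_, by simp⟩
    rintro (i | i) (j | j) h
    · simpa [Fin.ext_iff] using h
    · fin_cases j <;> simp [Fin.ext_iff] at h; omega
    · fin_cases i <;> simp [Fin.ext_iff] at h; omega
    · fin_cases i <;> fin_cases j <;> simp [Fin.ext_iff] at h ⊢

theorem adjugate_ends_det {m : ℕ} (M : Matrix (Fin (m + 2)) (Fin (m + 2)) R) :
    (M.adjugate.submatrix ![0, Fin.last (m + 1)] ![0, Fin.last (m + 1)]).det =
      (M.submatrix Fin.succ Fin.succ).det * (M.submatrix Fin.castSucc Fin.castSucc).det -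
        (M.submatrix Fin.castSucc Fin.succ).det * (M.submatrix Fin.succ Fin.castSucc).det := by
  have hsign : (-1 : R) ^ (m + 1) * (-1) ^ (m + 1) = 1 := by rw [← mul_pow]; simp
  simp only [det_fin_two, submatrix_apply, cons_val_zero, cons_val_one, cons_val_fin_one,
    adjugate_fin_succ_eq_det_submatrix, Fin.succAbove_zero, Fin.succAbove_last, Fin.val_zero,
    Fin.val_last, add_zero, zero_add, pow_zero, pow_add _ (m + 1) (m + 1), one_mul]
  linear_combination ((M.submatrix Fin.succ Fin.succ).det *
    (M.submatrix Fin.castSucc Fin.castSucc).det - (M.submatrix Fin.castSucc Fin.succ).det *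
      (M.submatrix Fin.succ Fin.castSucc).det) * hsign

theorem desnanot_jacobi_of_isRegular {m : ℕ} (M : Matrix (Fin (m + 2)) (Fin (m + 2)) R)
    (hM : IsRegular M.det) :
    M.det * (M.submatrix (Fin.castSucc ∘ Fin.succ) (Fin.castSucc ∘ Fin.succ)).det =
      (M.submatrix Fin.succ Fin.succ).det * (M.submatrix Fin.castSucc Fin.castSucc).det -
        (M.submatrix Fin.castSucc Fin.succ).det * (M.submatrix Fin.succ Fin.castSucc).det := by
  have hJacobi := det_mul_det_toBlocks₂₂_adjugate
    (M.submatrix (interiorEndsEquiv m) (interiorEndsEquiv m))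
  have hends : (M.submatrix (interiorEndsEquiv m) (interiorEndsEquiv m)).adjugate.toBlocks₂₂ =
      M.adjugate.submatrix ![0, Fin.last (m + 1)] ![0, Fin.last (m + 1)] := by
    rw [adjugate_submatrix_equiv_self]
    rfl
  have hinterior : (M.submatrix (interiorEndsEquiv m) (interiorEndsEquiv m)).toBlocks₁₁ =
      M.submatrix (Fin.castSucc ∘ Fin.succ) (Fin.castSucc ∘ Fin.succ) := rfl
  rw [hends, hinterior, det_submatrix_equiv_self, adjugate_ends_det, Fintype.card_fin, pow_two]
    at hJacobi
  apply hM.left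
  linear_combination -hJacobi

theorem desnanot_jacobi {m : ℕ} (M : Matrix (Fin (m + 2)) (Fin (m + 2)) R) :
    M.det * (M.submatrix (Fin.castSucc ∘ Fin.succ) (Fin.castSucc ∘ Fin.succ)).det =
      (M.submatrix Fin.succ Fin.succ).det * (M.submatrix Fin.castSucc Fin.castSucc).det -
        (M.submatrix Fin.castSucc Fin.succ).det * (M.submatrix Fin.succ Fin.castSucc).det := by
  have h := congrArg (Polynomial.evalRingHom 0)
    (desnanot_jacobi_of_isRegular (-M).charmatrix (isRegular_det_charmatrix (-M)))
  simpa only [map_mul, map_sub, RingHom.map_det, RingHom.mapMatrix_apply, ← submatrix_map,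
    map_eval_zero_charmatrix_neg] using h

theorem det_add_single_zero {m : ℕ} (M : Matrix (Fin (m + 1)) (Fin (m + 1)) R) (d : R) :
    (M + single 0 0 d).det = M.det + d * (M.submatrix Fin.succ Fin.succ).det := by
  have hminor : ∀ j : Fin (m + 1), (M + single 0 0 d).submatrix Fin.succ j.succAbove =
      M.submatrix Fin.succ j.succAbove := fun j => by
    ext i k
    simp [(Fin.succ_ne_zero i).symm]
  have hrow : ∀ j : Fin m, (0 : Fin (m + 1)) ≠ j.succ := fun j => (Fin.succ_ne_zero j).symm
  simp only [det_succ_row_zero, Fin.sum_univ_succ, hminor, Matrix.add_apply, single_apply, hrow,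
    Fin.succAbove_zero, Fin.val_zero, pow_zero, one_mul, and_self, and_false, if_true, if_false,
    add_zero]
  ring

theorem det_add_single_zero_mul {m : ℕ} (N : Matrix (Fin (m + 1)) (Fin (m + 1)) R) (d : R) :
    (N + single 0 0 d).det * (N.submatrix Fin.castSucc Fin.castSucc).det =
      N.det * ((N + single 0 0 d).submatrix Fin.castSucc Fin.castSucc).det +
        d * (N.submatrix Fin.succ Fin.castSucc).det * (N.submatrix Fin.castSucc Fin.succ).det := by
  cases m with
  | zero => simp
  | succ m =>
    have hsub : (N + single 0 0 d).submatrix Fin.castSucc Fin.castSucc =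
        N.submatrix Fin.castSucc Fin.castSucc + single 0 0 d := by
      ext i j
      simp [single_apply, Fin.ext_iff]
    rw [hsub, det_add_single_zero, det_add_single_zero, submatrix_submatrix]
    linear_combination -d * desnanot_jacobi N

theorem submatrix_castSucc_mul {m : ℕ} {ι : Type*} {X : Matrix (Fin (m + 1)) (Fin (m + 1)) R}
    (hX : X.IsLowerTriangular) (Y : Matrix (Fin (m + 1)) (Fin (m + 1)) R) (c : ι → Fin (m + 1)) :
    (X * Y).submatrix Fin.castSucc c =
      X.submatrix Fin.castSucc Fin.castSucc * Y.submatrix Fin.castSucc c := by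
  ext i j
  have hcorner : X i.castSucc (Fin.last m) = 0 := hX (Fin.castSucc_lt_last i)
  simp [mul_apply, Fin.sum_univ_castSucc, hcorner]

theorem submatrix_mul_castSucc {m : ℕ} {ι : Type*} {Y : Matrix (Fin (m + 1)) (Fin (m + 1)) R}
    (hY : Y.IsUpperTriangular) (X : Matrix (Fin (m + 1)) (Fin (m + 1)) R) (r : ι → Fin (m + 1)) :
    (X * Y).submatrix r Fin.castSucc =
      X.submatrix r Fin.castSucc * Y.submatrix Fin.castSucc Fin.castSucc := by
  ext i j
  have hcorner : Y (Fin.last m) j.castSucc = 0 := hY (Fin.castSucc_lt_last j)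
  simp [mul_apply, Fin.sum_univ_castSucc, hcorner]

theorem det_eq_det_castSucc_mul_of_isLowerTriangular {m : ℕ}
    {X : Matrix (Fin (m + 1)) (Fin (m + 1)) R} (hX : X.IsLowerTriangular) :
    X.det = (X.submatrix Fin.castSucc Fin.castSucc).det * X (Fin.last m) (Fin.last m) := by
  have hXc : (X.submatrix Fin.castSucc Fin.castSucc).IsLowerTriangular := fun i j hij =>
    hX (Fin.castSucc_lt_castSucc_iff.2 hij)
  rw [det_of_isLowerTriangular X hX, det_of_isLowerTriangular _ hXc, Fin.prod_univ_castSucc]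
  rfl

theorem det_eq_det_castSucc_mul_of_isUpperTriangular {m : ℕ}
    {Y : Matrix (Fin (m + 1)) (Fin (m + 1)) R} (hY : Y.IsUpperTriangular) :
    Y.det = (Y.submatrix Fin.castSucc Fin.castSucc).det * Y (Fin.last m) (Fin.last m) := by
  have := det_eq_det_castSucc_mul_of_isLowerTriangular (X := Yᵀ) hY.transpose
  rwa [det_transpose, ← transpose_submatrix, det_transpose] at this

theorem det_triangular_mul_mul_triangular_add_single_of_isRegular {m : ℕ}
    {X Y : Matrix (Fin (m + 1)) (Fin (m + 1)) R} (hX : X.IsLowerTriangular)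
    (hY : Y.IsUpperTriangular) (hXreg : IsRegular X.det) (hYreg : IsRegular Y.det)
    (Q : Matrix (Fin (m + 1)) (Fin (m + 1)) R) (d : R) :
    (X * Q * Y + single 0 0 d).det * (Q.submatrix Fin.castSucc Fin.castSucc).det =
      X (Fin.last m) (Fin.last m) * Y (Fin.last m) (Fin.last m) * Q.det *
          ((X * Q * Y + single 0 0 d).submatrix Fin.castSucc Fin.castSucc).det +
        d * ((X * Q).submatrix Fin.succ Fin.castSucc).det *
          ((Q * Y).submatrix Fin.castSucc Fin.succ).det := by
  have h := det_add_single_zero_mul (X * Q * Y) d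
  rw [submatrix_mul_castSucc hY, submatrix_mul_castSucc hY, submatrix_castSucc_mul hX,
    mul_assoc X Q Y, submatrix_castSucc_mul hX, ← mul_assoc X Q Y] at h
  simp only [det_mul] at h
  rw [det_eq_det_castSucc_mul_of_isLowerTriangular hX,
    det_eq_det_castSucc_mul_of_isUpperTriangular hY] at h
  rw [det_eq_det_castSucc_mul_of_isLowerTriangular hX, isRegular_mul_iff] at hXreg
  rw [det_eq_det_castSucc_mul_of_isUpperTriangular hY, isRegular_mul_iff] at hYreg
  apply (hXreg.1.mul hYreg.1).left
  linear_combination h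

theorem det_triangular_mul_mul_triangular_add_single {m : ℕ}
    {X Y : Matrix (Fin (m + 1)) (Fin (m + 1)) R} (hX : X.IsLowerTriangular)
    (hY : Y.IsUpperTriangular) (Q : Matrix (Fin (m + 1)) (Fin (m + 1)) R) (d : R) :
    (X * Q * Y + single 0 0 d).det * (Q.submatrix Fin.castSucc Fin.castSucc).det =
      X (Fin.last m) (Fin.last m) * Y (Fin.last m) (Fin.last m) * Q.det *
          ((X * Q * Y + single 0 0 d).submatrix Fin.castSucc Fin.castSucc).det +
        d * ((X * Q).submatrix Fin.succ Fin.castSucc).det *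
          ((Q * Y).submatrix Fin.castSucc Fin.succ).det := by
  have h := congrArg (Polynomial.evalRingHom 0)
    (det_triangular_mul_mul_triangular_add_single_of_isRegular (X := (-X).charmatrix)
      (Y := (-Y).charmatrix) (BlockTriangular.charmatrix hX.neg) (BlockTriangular.charmatrix hY.neg)
      (isRegular_det_charmatrix _) (isRegular_det_charmatrix _) (Q.map Polynomial.C)
      (Polynomial.C d))
  have hQ : (Q.map Polynomial.C).map (Polynomial.evalRingHom 0) = Q := by ext; simp
  have hC : Polynomial.evalRingHom 0 (Polynomial.C d) = d := by simp
  have hd : (single 0 0 (Polynomial.C d)).map (Polynomial.evalRingHom 0) =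
      (single 0 0 d : Matrix (Fin (m + 1)) (Fin (m + 1)) R) := by
    rw [map_single, hC]
  have hlast : ∀ Z : Matrix (Fin (m + 1)) (Fin (m + 1)) R, (Polynomial.evalRingHom 0)
      ((-Z).charmatrix (Fin.last m) (Fin.last m)) = Z (Fin.last m) (Fin.last m) := fun Z =>
    congrFun (congrFun (map_eval_zero_charmatrix_neg Z) _) _
  simpa only [map_mul, map_add, RingHom.map_det, RingHom.mapMatrix_apply, ← submatrix_map,
    Matrix.map_mul, Matrix.map_add _ (map_add (Polynomial.evalRingHom (0 : R))),
    map_eval_zero_charmatrix_neg, hQ, hd, hlast, hC] using h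

end Determinants

/-- The step weights of a directed network on `ℕ × ℕ`: `h u v` is the weight of the step
`(u, v) → (u + 1, v)`, `w u v` that of `(u, v + 1) → (u, v)`, and `d u v` that of
`(u, v + 1) → (u + 1, v)`. -/
structure StepWeights (R : Type*) where
  h : ℕ → ℕ → R
  w : ℕ → ℕ → R
  d : ℕ → ℕ → R

namespace StepWeights

variable {R : Type*}

/-- The weights of the network seen from `(a, b)`. -/
@[simps]
def shift (W : StepWeights R) (a b : ℕ) : StepWeights R where
  h u v := W.h (a + u) (b + v)
  w u v := W.w (a + u) (b + v)
  d u v := W.d (a + u) (b + v)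

theorem shift_shift (W : StepWeights R) (a b a' b' : ℕ) :
    (W.shift a b).shift a' b' = W.shift (a + a') (b + b') := by
  simp only [shift, add_assoc]

theorem shift_zero_zero (W : StepWeights R) : W.shift 0 0 = W := by
  simp only [shift, zero_add]

theorem shift_one_zero_shift_zero_one (W : StepWeights R) :
    (W.shift 1 0).shift 0 1 = (W.shift 0 1).shift 1 0 := by
  simp only [shift_shift, zero_add, add_zero]

variable [CommRing R]

/-- The weighted number of paths from `(0, b)` to `(a, 0)`, by recursion on the first step. -/
def pathSum (W : StepWeights R) : ℕ → ℕ → R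
  | 0, 0 => 1
  | a + 1, 0 => W.h 0 0 * (W.shift 1 0).pathSum a 0
  | 0, b + 1 => W.w 0 b * W.pathSum 0 b
  | a + 1, b + 1 =>
    W.h 0 (b + 1) * (W.shift 1 0).pathSum a (b + 1) + W.w 0 b * W.pathSum (a + 1) b +
      W.d 0 b * (W.shift 1 0).pathSum a b

theorem pathSum_zero_zero (W : StepWeights R) : W.pathSum 0 0 = 1 := by
  rw [pathSum]

theorem pathSum_succ_zero (W : StepWeights R) (a : ℕ) :
    W.pathSum (a + 1) 0 = W.h 0 0 * (W.shift 1 0).pathSum a 0 := by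
  rw [pathSum]

theorem pathSum_zero_succ (W : StepWeights R) (b : ℕ) :
    W.pathSum 0 (b + 1) = W.w 0 b * W.pathSum 0 b := by
  rw [pathSum]

theorem pathSum_succ_succ (W : StepWeights R) (a b : ℕ) :
    W.pathSum (a + 1) (b + 1) =
      W.h 0 (b + 1) * (W.shift 1 0).pathSum a (b + 1) + W.w 0 b * W.pathSum (a + 1) b +
        W.d 0 b * (W.shift 1 0).pathSum a b := by
  rw [pathSum]

theorem pathSum_succ_zero_last (W : StepWeights R) (a : ℕ) :
    W.pathSum (a + 1) 0 = W.h a 0 * W.pathSum a 0 := by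
  induction a generalizing W with
  | zero => simp only [pathSum]
  | succ a ih =>
    rw [pathSum_succ_zero, ih, pathSum_succ_zero, mul_left_comm]
    simp only [shift_h, add_zero, add_comm 1 a]

theorem pathSum_zero_succ_last (W : StepWeights R) (b : ℕ) :
    W.pathSum 0 (b + 1) = W.w 0 0 * (W.shift 0 1).pathSum 0 b := by
  induction b with
  | zero => simp only [pathSum]
  | succ b ih =>
    rw [pathSum_zero_succ, ih, pathSum_zero_succ, mul_left_comm]
    simp only [shift_w, add_zero, add_comm 1 b]

theorem pathSum_succ_one_last (W : StepWeights R) (a : ℕ) :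
    W.pathSum (a + 1) 1 =
      W.h a 0 * W.pathSum a 1 + W.w (a + 1) 0 * (W.shift 0 1).pathSum (a + 1) 0 +
        W.d a 0 * (W.shift 0 1).pathSum a 0 := by
  induction a generalizing W with
  | zero =>
    simp only [pathSum, shift_h, shift_w]
    ring
  | succ a ih =>
    rw [pathSum_succ_succ W (a + 1) 0, ih (W.shift 1 0), shift_one_zero_shift_zero_one,
      pathSum_succ_zero_last W (a + 1), pathSum_succ_zero_last (W.shift 1 0) a,
      pathSum_succ_succ W a 0, pathSum_succ_zero (W.shift 0 1) (a + 1),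
      pathSum_succ_zero (W.shift 0 1) a]
    simp only [shift_h, shift_w, shift_d, add_zero, zero_add, add_comm 1]
    ring

theorem pathSum_succ_succ_last (W : StepWeights R) (a b : ℕ) :
    W.pathSum (a + 1) (b + 1) =
      W.h a 0 * W.pathSum a (b + 1) + W.w (a + 1) 0 * (W.shift 0 1).pathSum (a + 1) b +
        W.d a 0 * (W.shift 0 1).pathSum a b := by
  induction b generalizing W a with
  | zero => exact W.pathSum_succ_one_last a
  | succ b ihb =>
    induction a generalizing W with
    | zero =>
      rw [pathSum_succ_succ W 0 (b + 1), pathSum_zero_succ_last (W.shift 1 0) (b + 1), ihb W 0,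
        pathSum_zero_succ_last (W.shift 1 0) b, shift_one_zero_shift_zero_one,
        pathSum_zero_succ W (b + 1), pathSum_succ_succ (W.shift 0 1) 0 b,
        pathSum_zero_succ (W.shift 0 1) b]
      simp only [shift_h, shift_w, shift_d, add_zero, add_comm 1]
      ring
    | succ a iha =>
      rw [pathSum_succ_succ W (a + 1) (b + 1), iha (W.shift 1 0), ihb W (a + 1),
        ihb (W.shift 1 0) a, shift_one_zero_shift_zero_one, pathSum_succ_succ W a (b + 1),
        pathSum_succ_succ (W.shift 0 1) (a + 1) b, pathSum_succ_succ (W.shift 0 1) a b]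
      simp only [shift_h, shift_w, shift_d, add_zero, add_comm 1]
      ring

end StepWeights

section Bidiagonal

open Matrix

variable {R : Type*}

/-- The lower bidiagonal matrix with diagonal entries `a i` and entries `b i` in the positions
`(i + 1, i)`. -/
def lowerBidiagonal [Zero R] (a b : ℕ → R) (k : ℕ) : Matrix (Fin k) (Fin k) R :=
  of fun i j => if j = i then a i else if (j : ℕ) + 1 = i then b j else 0

theorem lowerBidiagonal_apply_self [Zero R] (a b : ℕ → R) {k : ℕ} (i : Fin k) :
    lowerBidiagonal a b k i i = a i := by
  simp [lowerBidiagonal]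

theorem isLowerTriangular_lowerBidiagonal [Zero R] (a b : ℕ → R) (k : ℕ) :
    (lowerBidiagonal a b k).IsLowerTriangular := by
  intro i j (hij : i < j)
  simp only [lowerBidiagonal, of_apply]
  rw [if_neg hij.ne', if_neg (by omega)]

variable [CommRing R] {ι : Type*} {k : ℕ}

theorem lowerBidiagonal_mul_zero (a b : ℕ → R) (M : Matrix (Fin (k + 1)) ι R) (j : ι) :
    (lowerBidiagonal a b (k + 1) * M) 0 j = a 0 * M 0 j := by
  simp [lowerBidiagonal, mul_apply]

theorem lowerBidiagonal_mul_succ (a b : ℕ → R) (M : Matrix (Fin (k + 1)) ι R) (i : Fin k)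
    (j : ι) :
    (lowerBidiagonal a b (k + 1) * M) i.succ j =
      a (i + 1) * M i.succ j + b i * M i.castSucc j := by
  have hrow : ∀ l : Fin (k + 1), lowerBidiagonal a b (k + 1) i.succ l =
      (if l = i.succ then a (i + 1) else 0) + if l = i.castSucc then b i else 0 := fun l => by
    simp only [lowerBidiagonal, of_apply, Fin.ext_iff, Fin.val_succ, Fin.val_castSucc]
    split_ifs <;> first | omega | simp_all
  simp [mul_apply, hrow, add_mul, Finset.sum_add_distrib]

theorem mul_transpose_lowerBidiagonal_zero (a b : ℕ → R) (M : Matrix ι (Fin (k + 1)) R) (i : ι) :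
    (M * (lowerBidiagonal a b (k + 1))ᵀ) i 0 = a 0 * M i 0 := by
  rw [← transpose_transpose M, ← transpose_mul]
  exact lowerBidiagonal_mul_zero a b Mᵀ i

theorem mul_transpose_lowerBidiagonal_succ (a b : ℕ → R) (M : Matrix ι (Fin (k + 1)) R) (i : ι)
    (j : Fin k) :
    (M * (lowerBidiagonal a b (k + 1))ᵀ) i j.succ =
      a (j + 1) * M i j.succ + b j * M i j.castSucc := by
  rw [← transpose_transpose M, ← transpose_mul]
  exact lowerBidiagonal_mul_succ a b Mᵀ j i

theorem det_eq_det_succ_of_column_zero {M : Matrix (Fin (k + 1)) (Fin (k + 1)) R}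
    (h0 : M 0 0 = 1) (hcol : ∀ i : Fin k, M i.succ 0 = 0) :
    M.det = (M.submatrix Fin.succ Fin.succ).det := by
  simp [det_succ_column_zero, Fin.sum_univ_succ, h0, hcol]

end Bidiagonal

namespace StepWeights

open Matrix

variable {R : Type*} [CommRing R]

/-- The network without the steps `w` along `u = 0`. -/
@[simps]
def trimLeft (W : StepWeights R) : StepWeights R where
  h := W.h
  w u v := if u = 0 then 0 else W.w u v
  d := W.d

/-- The network without the steps `h` along `v = 0`. -/
@[simps]
def trimBottom (W : StepWeights R) : StepWeights R where
  h u v := if v = 0 then 0 else W.h u v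
  w := W.w
  d := W.d

/-- The network without the steps along the two border lines. -/
def trim (W : StepWeights R) : StepWeights R :=
  W.trimBottom.trimLeft

theorem trimLeft_shift_succ (W : StepWeights R) (a b : ℕ) :
    W.trimLeft.shift (a + 1) b = W.shift (a + 1) b := by
  simp [shift, add_assoc, add_comm 1]

theorem trimBottom_shift_succ (W : StepWeights R) (a b : ℕ) :
    W.trimBottom.shift a (b + 1) = W.shift a (b + 1) := by
  simp [shift, add_assoc, add_comm 1]

theorem trimBottom_shift_zero (W : StepWeights R) (a : ℕ) :
    W.trimBottom.shift a 0 = (W.shift a 0).trimBottom := by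
  simp [shift, trimBottom]

theorem trimLeft_pathSum_zero_succ (W : StepWeights R) (b : ℕ) :
    W.trimLeft.pathSum 0 (b + 1) = 0 := by
  simp [pathSum_zero_succ]

theorem trimLeft_pathSum_succ_zero (W : StepWeights R) (a : ℕ) :
    W.trimLeft.pathSum (a + 1) 0 = W.h 0 0 * (W.shift 1 0).pathSum a 0 := by
  rw [pathSum_succ_zero, trimLeft_shift_succ, trimLeft_h]

theorem trimLeft_pathSum_succ_succ (W : StepWeights R) (a b : ℕ) :
    W.trimLeft.pathSum (a + 1) (b + 1) =
      W.h 0 (b + 1) * (W.shift 1 0).pathSum a (b + 1) + W.d 0 b * (W.shift 1 0).pathSum a b := by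
  simp [pathSum_succ_succ, trimLeft_shift_succ]

theorem trimBottom_pathSum_succ_zero (W : StepWeights R) (a : ℕ) :
    W.trimBottom.pathSum (a + 1) 0 = 0 := by
  simp [pathSum_succ_zero_last]

theorem trimBottom_pathSum_zero_succ (W : StepWeights R) (b : ℕ) :
    W.trimBottom.pathSum 0 (b + 1) = W.w 0 0 * (W.shift 0 1).pathSum 0 b := by
  rw [pathSum_zero_succ_last, trimBottom_shift_succ, trimBottom_w]

theorem trimBottom_pathSum_succ_succ (W : StepWeights R) (a b : ℕ) :
    W.trimBottom.pathSum (a + 1) (b + 1) =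
      W.w (a + 1) 0 * (W.shift 0 1).pathSum (a + 1) b + W.d a 0 * (W.shift 0 1).pathSum a b := by
  simp [pathSum_succ_succ_last, trimBottom_shift_succ]

theorem pathSum_succ_eq_trimLeft_add (W : StepWeights R) (a b : ℕ) :
    W.pathSum a (b + 1) = W.trimLeft.pathSum a (b + 1) + W.w 0 b * W.pathSum a b := by
  cases a with
  | zero => rw [trimLeft_pathSum_zero_succ, pathSum_zero_succ, zero_add]
  | succ a =>
    rw [trimLeft_pathSum_succ_succ, pathSum_succ_succ]
    ring

theorem pathSum_succ_eq_trimBottom_add (W : StepWeights R) (a b : ℕ) :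
    W.pathSum (a + 1) b = W.trimBottom.pathSum (a + 1) b + W.h a 0 * W.pathSum a b := by
  cases b with
  | zero => rw [trimBottom_pathSum_succ_zero, pathSum_succ_zero_last, zero_add]
  | succ b =>
    rw [trimBottom_pathSum_succ_succ, pathSum_succ_succ_last]
    ring

/-- The matrix of the path sums from `(0, i)` to `(j, 0)`, for `i, j < k`. -/
def pathMatrix (W : StepWeights R) (k : ℕ) : Matrix (Fin k) (Fin k) R :=
  of fun i j => W.pathSum j i

/-- The determinant of the path sums from the vertices `(0, i)` to the vertices `(j, 0)` with
`i, j < k`. -/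
def pathDet (W : StepWeights R) (k : ℕ) : R :=
  (W.pathMatrix k).det

theorem pathDet_zero (W : StepWeights R) : W.pathDet 0 = 1 :=
  det_isEmpty

theorem pathDet_one (W : StepWeights R) : W.pathDet 1 = 1 := by
  simp [pathDet, pathMatrix, pathSum_zero_zero]

theorem pathDet_trimLeft (W : StepWeights R) (k : ℕ) : W.trimLeft.pathDet k = W.pathDet k := by
  cases k with
  | zero => rw [pathDet_zero, pathDet_zero]
  | succ k =>
    refine (det_eq_of_forall_row_eq_smul_add_pred (fun i => W.w 0 i) (fun j => ?_)
      fun i j => W.pathSum_succ_eq_trimLeft_add j i).symm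
    refine Fin.cases ?_ (fun j => ?_) j
    · exact W.pathSum_zero_zero.trans W.trimLeft.pathSum_zero_zero.symm
    · exact (W.pathSum_succ_zero j).trans (W.trimLeft_pathSum_succ_zero j).symm

theorem pathDet_trimBottom (W : StepWeights R) (k : ℕ) : W.trimBottom.pathDet k = W.pathDet k := by
  cases k with
  | zero => rw [pathDet_zero, pathDet_zero]
  | succ k =>
    refine (det_eq_of_forall_col_eq_smul_add_pred (fun j => W.h j 0) (fun i => ?_)
      fun i j => W.pathSum_succ_eq_trimBottom_add j i).symm
    refine Fin.cases ?_ (fun i => ?_) i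
    · exact W.pathSum_zero_zero.trans W.trimBottom.pathSum_zero_zero.symm
    · exact (W.pathSum_zero_succ_last i).trans (W.trimBottom_pathSum_zero_succ i).symm

theorem pathDet_trim (W : StepWeights R) (k : ℕ) : W.trim.pathDet k = W.pathDet k :=
  (pathDet_trimLeft _ k).trans (W.pathDet_trimBottom k)

theorem pathDet_succ_eq_det_trimLeft (W : StepWeights R) (k : ℕ) :
    W.pathDet (k + 1) = (of fun i j : Fin k => W.trimLeft.pathSum (j + 1) (i + 1)).det := by
  rw [← pathDet_trimLeft]
  exact det_eq_det_succ_of_column_zero (pathSum_zero_zero _) fun i => W.trimLeft_pathSum_zero_succ i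

theorem pathDet_succ_eq_det_trimBottom (W : StepWeights R) (k : ℕ) :
    W.pathDet (k + 1) = (of fun i j : Fin k => W.trimBottom.pathSum (j + 1) (i + 1)).det := by
  rw [← pathDet_trimBottom, pathDet, ← det_transpose, ← det_transpose (of _)]
  exact det_eq_det_succ_of_column_zero (pathSum_zero_zero _) fun i =>
    W.trimBottom_pathSum_succ_zero i

theorem pathDet_succ_eq_det_trim (W : StepWeights R) (k : ℕ) :
    W.pathDet (k + 1) = (of fun i j : Fin k => W.trim.pathSum (j + 1) (i + 1)).det := by
  rw [← pathDet_trimBottom, pathDet_succ_eq_det_trimLeft, trim]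

theorem lowerBidiagonal_mul_pathMatrix (W : StepWeights R) (k : ℕ) :
    lowerBidiagonal (W.h 0) (W.d 0) (k + 1) * (W.shift 1 0).pathMatrix (k + 1) =
      of fun i j : Fin (k + 1) => W.trimLeft.pathSum (j + 1) i := by
  ext i j
  refine Fin.cases ?_ (fun i => ?_) i
  · rw [lowerBidiagonal_mul_zero]
    exact (W.trimLeft_pathSum_succ_zero j).symm
  · rw [lowerBidiagonal_mul_succ]
    exact (W.trimLeft_pathSum_succ_succ j i).symm

theorem pathMatrix_mul_transpose_lowerBidiagonal (W : StepWeights R) (k : ℕ) :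
    (W.shift 0 1).pathMatrix (k + 1) * (lowerBidiagonal (W.w · 0) (W.d · 0) (k + 1))ᵀ =
      of fun i j : Fin (k + 1) => W.trimBottom.pathSum j (i + 1) := by
  ext i j
  refine Fin.cases ?_ (fun j => ?_) j
  · rw [mul_transpose_lowerBidiagonal_zero]
    exact (W.trimBottom_pathSum_zero_succ i).symm
  · rw [mul_transpose_lowerBidiagonal_succ]
    exact (W.trimBottom_pathSum_succ_succ j i).symm

/-- The steps leaving the line `u = 0` form the left factor, those entering the line `v = 0` the
right one; the only path with a step that does both is the diagonal step `(0, 1) → (1, 0)`. -/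
theorem trim_pathSum_matrix_eq (W : StepWeights R) (k : ℕ) :
    (of fun i j : Fin (k + 1) => W.trim.pathSum (j + 1) (i + 1)) =
      lowerBidiagonal ((W.shift 0 1).h 0) ((W.shift 0 1).d 0) (k + 1) *
          (W.shift 1 1).pathMatrix (k + 1) *
          (lowerBidiagonal ((W.shift 1 0).w · 0) ((W.shift 1 0).d · 0) (k + 1))ᵀ +
        single 0 0 (W.d 0 0) := by
  have hright := (W.shift 1 0).pathMatrix_mul_transpose_lowerBidiagonal k
  rw [shift_shift, add_zero, zero_add] at hright
  rw [mul_assoc, hright]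
  ext i j
  rw [of_apply, trim, trimLeft_pathSum_succ_succ, trimBottom_shift_zero]
  refine Fin.cases ?_ (fun i => ?_) i
  · rw [Matrix.add_apply, lowerBidiagonal_mul_zero]
    refine Fin.cases ?_ (fun j => ?_) j
    · simp [pathSum_zero_zero]
    · simp [trimBottom_pathSum_succ_zero, (Fin.succ_ne_zero _).symm]
  · rw [Matrix.add_apply, lowerBidiagonal_mul_succ]
    simp [add_comm 1, (Fin.succ_ne_zero _).symm]

theorem pathDet_condensation (W : StepWeights R) (k : ℕ) :
    W.pathDet (k + 2) * (W.shift 1 1).pathDet k =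
      W.h 0 (k + 1) * W.w (k + 1) 0 * (W.shift 1 1).pathDet (k + 1) * W.pathDet (k + 1) +
        W.d 0 0 * (W.shift 0 1).pathDet (k + 1) * (W.shift 1 0).pathDet (k + 1) := by
  have hleft := (W.shift 0 1).lowerBidiagonal_mul_pathMatrix k
  have hright := (W.shift 1 0).pathMatrix_mul_transpose_lowerBidiagonal k
  simp only [shift_shift, zero_add, add_zero] at hleft hright
  have key := det_triangular_mul_mul_triangular_add_single
    (isLowerTriangular_lowerBidiagonal ((W.shift 0 1).h 0) ((W.shift 0 1).d 0) (k + 1))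
    (isLowerTriangular_lowerBidiagonal ((W.shift 1 0).w · 0) ((W.shift 1 0).d · 0)
      (k + 1)).transpose ((W.shift 1 1).pathMatrix (k + 1)) (W.d 0 0)
  rw [← W.trim_pathSum_matrix_eq k, hleft, hright, transpose_apply, lowerBidiagonal_apply_self,
    lowerBidiagonal_apply_self] at key
  rw [W.pathDet_succ_eq_det_trim (k + 1), W.pathDet_succ_eq_det_trim k,
    (W.shift 0 1).pathDet_succ_eq_det_trimLeft, (W.shift 1 0).pathDet_succ_eq_det_trimBottom]
  simp only [shift_h, shift_w, Fin.val_last, add_zero, add_comm 1] at key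
  exact key

end StepWeights

section Exchange

variable {ι V : Type*}

/-- Two lists of the family share a vertex. -/
def Intersecting (L : ι → List V) : Prop :=
  ∃ v i j, i ≠ j ∧ v ∈ L i ∧ v ∈ L j

theorem not_intersecting_iff {L : ι → List V} :
    ¬ Intersecting L ↔ ∀ i j, i ≠ j → (L i).Disjoint (L j) := by
  constructor
  · exact fun h i j hij v hi hj => h ⟨v, i, j, hij, hi, hj⟩
  · rintro h ⟨v, i, j, hij, hi, hj⟩
    exact h i j hij hi hj

section IsSwapAt

variable [DecidableEq ι] {p : V} {L : ι → List V} {τ : Equiv.Perm ι}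

/-- `τ` transposes two indices of lists that contain `p`. -/
def IsSwapAt (p : V) (L : ι → List V) (τ : Equiv.Perm ι) : Prop :=
  ∃ i j, i ≠ j ∧ p ∈ L i ∧ p ∈ L j ∧ τ = Equiv.swap i j

theorem IsSwapAt.apply_eq_or_mem (h : IsSwapAt p L τ) (k : ι) :
    τ k = k ∨ (p ∈ L k ∧ p ∈ L (τ k)) := by
  obtain ⟨i, j, -, hi, hj, rfl⟩ := h
  rcases eq_or_ne k i with rfl | hki
  · exact .inr ⟨hi, by rwa [Equiv.swap_apply_left]⟩
  rcases eq_or_ne k j with rfl | hkj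
  · exact .inr ⟨hj, by rwa [Equiv.swap_apply_right]⟩
  exact .inl (Equiv.swap_apply_of_ne_of_ne hki hkj)

theorem IsSwapAt.mul_self (h : IsSwapAt p L τ) : τ * τ = 1 := by
  obtain ⟨i, j, -, -, -, rfl⟩ := h
  exact Equiv.swap_mul_self i j

theorem IsSwapAt.apply_apply (h : IsSwapAt p L τ) (k : ι) : τ (τ k) = k :=
  Equiv.congr_fun h.mul_self k

end IsSwapAt

variable [DecidableEq V]

/-- The list `l` up to its first occurrence of `p`, followed by `l'` from its first occurrence of
`p` on. -/
def cut (p : V) (l l' : List V) : List V :=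
  l.takeWhile (fun q => decide (q ≠ p)) ++ l'.dropWhile (fun q => decide (q ≠ p))

theorem takeWhile_ne_append_cons {p : V} {a : List V} (ha : p ∉ a) (b : List V) :
    (a ++ p :: b).takeWhile (fun q => decide (q ≠ p)) = a := by
  rw [List.takeWhile_append_of_pos fun q hq => by simpa using fun h : q = p => ha (h ▸ hq)]
  simp

theorem dropWhile_ne_append_cons {p : V} {a : List V} (ha : p ∉ a) (b : List V) :
    (a ++ p :: b).dropWhile (fun q => decide (q ≠ p)) = p :: b := by
  rw [List.dropWhile_append_of_pos fun q hq => by simpa using fun h : q = p => ha (h ▸ hq)]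
  simp

theorem cut_append_cons {p : V} {a a' : List V} (ha : p ∉ a) (ha' : p ∉ a') (b b' : List V) :
    cut p (a ++ p :: b) (a' ++ p :: b') = a ++ p :: b' := by
  rw [cut, takeWhile_ne_append_cons ha, dropWhile_ne_append_cons ha']

theorem cut_self (p : V) (l : List V) : cut p l l = l :=
  List.takeWhile_append_dropWhile

theorem cut_cut {p : V} {l l' : List V} (h : p ∈ l) (h' : p ∈ l') :
    cut p (cut p l l') (cut p l' l) = l := by
  obtain ⟨a, b, rfl, ha⟩ := List.eq_append_cons_of_mem h
  obtain ⟨a', b', rfl, ha'⟩ := List.eq_append_cons_of_mem h'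
  rw [cut_append_cons ha ha', cut_append_cons ha' ha, cut_append_cons ha ha']

theorem mem_cut_of_mem {p : V} (l : List V) {l' : List V} (h' : p ∈ l') : p ∈ cut p l l' := by
  obtain ⟨a', b', rfl, ha'⟩ := List.eq_append_cons_of_mem h'
  rw [cut, dropWhile_ne_append_cons ha']
  simp

/-- The family obtained by exchanging tails at `p` along a permutation of the indices. -/
def exchange (p : V) (τ : Equiv.Perm ι) (L : ι → List V) : ι → List V :=
  fun k => cut p (L k) (L (τ k))

theorem IsSwapAt.mem_exchange_iff [DecidableEq ι] {p : V} {L : ι → List V} {τ : Equiv.Perm ι}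
    (h : IsSwapAt p L τ) (k : ι) : p ∈ exchange p τ L k ↔ p ∈ L k := by
  rw [exchange]
  rcases h.apply_eq_or_mem k with hk | ⟨hk, hk'⟩
  · rw [hk, cut_self]
  · exact iff_of_true (mem_cut_of_mem _ hk') hk

theorem IsSwapAt.isSwapAt_exchange [DecidableEq ι] {p : V} {L : ι → List V} {τ : Equiv.Perm ι}
    (h : IsSwapAt p L τ) : IsSwapAt p (exchange p τ L) = IsSwapAt p L := by
  funext σ
  simp only [IsSwapAt, h.mem_exchange_iff]

theorem IsSwapAt.exchange_exchange [DecidableEq ι] {p : V} {L : ι → List V} {τ : Equiv.Perm ι}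
    (h : IsSwapAt p L τ) : exchange p τ (exchange p τ L) = L := by
  funext k
  simp only [exchange, h.apply_apply]
  rcases h.apply_eq_or_mem k with hk | ⟨hk, hk'⟩
  · simp only [hk, cut_self]
  · exact cut_cut hk hk'

theorem IsSwapAt.prod_exchange [Fintype ι] [DecidableEq ι] {R : Type*} [CommMonoid R]
    {wt : List V → R} (hwt : ∀ a p b, wt (a ++ p :: b) = wt (a ++ [p]) * wt (p :: b))
    {p : V} {L : ι → List V} {τ : Equiv.Perm ι} (h : IsSwapAt p L τ) :
    ∏ k, wt (exchange p τ L k) = ∏ k, wt (L k) := by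
  let front : ι → R := fun k =>
    if p ∈ L k then wt ((L k).takeWhile (fun q => decide (q ≠ p)) ++ [p]) else wt (L k)
  let tail : ι → R := fun k =>
    if p ∈ L k then wt ((L k).dropWhile (fun q => decide (q ≠ p))) else 1
  have hsplit : ∀ k, wt (L k) = front k * tail k := fun k => by
    simp only [front, tail]
    split_ifs with hk
    · obtain ⟨a, b, hab, ha⟩ := List.eq_append_cons_of_mem hk
      rw [hab, takeWhile_ne_append_cons ha, dropWhile_ne_append_cons ha, hwt]
    · rw [mul_one]
  have hexchange : ∀ k, wt (exchange p τ L k) = front k * tail (τ k) := fun k => by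
    rcases h.apply_eq_or_mem k with hk | ⟨hk, hk'⟩
    · rw [exchange, hk, cut_self, hsplit]
    · simp only [front, tail, if_pos hk, if_pos hk', exchange]
      obtain ⟨a, b, hab, ha⟩ := List.eq_append_cons_of_mem hk
      obtain ⟨a', b', hab', ha'⟩ := List.eq_append_cons_of_mem hk'
      rw [hab, hab', takeWhile_ne_append_cons ha, dropWhile_ne_append_cons ha',
        cut_append_cons ha ha', hwt]
  simp only [hsplit, hexchange, Finset.prod_mul_distrib]
  rw [Equiv.prod_comp τ tail]

variable [Fintype ι]

/-- The number of occurrences of a vertex in a family of lists; it is invariant under the exchange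
of tails. -/
def occurrences (L : ι → List V) (v : V) : ℕ :=
  ∑ k, (L k).count v

theorem occurrences_exchange (p : V) (τ : Equiv.Perm ι) (L : ι → List V) :
    occurrences (exchange p τ L) = occurrences L := by
  funext v
  simp only [occurrences, exchange, cut, List.count_append, Finset.sum_add_distrib]
  rw [Equiv.sum_comp τ fun k => ((L k).dropWhile fun q => decide (q ≠ p)).count v,
    ← Finset.sum_add_distrib]
  refine Finset.sum_congr rfl fun k _ => ?_
  rw [← List.count_append, List.takeWhile_append_dropWhile]

theorem two_le_occurrences_iff {L : ι → List V} (hL : ∀ k, (L k).Nodup) (v : V) :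
    2 ≤ occurrences L v ↔ ∃ i j, i ≠ j ∧ v ∈ L i ∧ v ∈ L j := by
  have hcard : occurrences L v = (Finset.univ.filter fun k => v ∈ L k).card := by
    rw [Finset.card_filter]
    exact Finset.sum_congr rfl fun k _ => (hL k).count
  rw [hcard, Nat.succ_le_iff, Finset.one_lt_card]
  simp only [Finset.mem_filter, Finset.mem_univ, true_and]
  constructor
  · rintro ⟨i, hi, j, hj, hij⟩
    exact ⟨i, j, hij, hi, hj⟩
  · rintro ⟨i, j, hij, hi, hj⟩
    exact ⟨i, hi, j, hj, hij⟩

theorem intersecting_iff_exists_two_le_occurrences {L : ι → List V} (hL : ∀ k, (L k).Nodup) :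
    Intersecting L ↔ ∃ v, 2 ≤ occurrences L v :=
  exists_congr fun v => (two_le_occurrences_iff hL v).symm

variable [Nonempty V]

/-- A vertex with at least two occurrences, if there is one. It is chosen from the numbers of
occurrences alone, so that it does not change when tails are exchanged. -/
def pivot (L : ι → List V) : V :=
  Classical.epsilon fun v => 2 ≤ occurrences L v

theorem two_le_occurrences_pivot {L : ι → List V} (h : ∃ v, 2 ≤ occurrences L v) :
    2 ≤ occurrences L (pivot L) :=
  Classical.epsilon_spec h

theorem pivot_exchange (p : V) (τ : Equiv.Perm ι) (L : ι → List V) :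
    pivot (exchange p τ L) = pivot L := by
  rw [pivot, occurrences_exchange, pivot]

variable [DecidableEq ι]

/-- A transposition of two indices of lists through the pivot, if there is one. It is chosen from
the set of all such indices alone, so that it does not change when tails are exchanged. -/
def pivotSwap (L : ι → List V) : Equiv.Perm ι :=
  Classical.epsilon (IsSwapAt (pivot L) L)

/-- The exchange of the tails of two lists through the pivot. -/
def pivotExchange (L : ι → List V) : ι → List V :=
  exchange (pivot L) (pivotSwap L) L

theorem isSwapAt_pivotSwap {L : ι → List V} (hL : ∀ k, (L k).Nodup) (h : Intersecting L) :
    IsSwapAt (pivot L) L (pivotSwap L) := by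
  have hpivot := two_le_occurrences_pivot ((intersecting_iff_exists_two_le_occurrences hL).1 h)
  obtain ⟨i, j, hij, hi, hj⟩ := (two_le_occurrences_iff hL _).1 hpivot
  exact Classical.epsilon_spec ⟨_, i, j, hij, hi, hj, rfl⟩

theorem pivot_pivotExchange (L : ι → List V) : pivot (pivotExchange L) = pivot L :=
  pivot_exchange _ _ _

theorem pivotSwap_pivotExchange {L : ι → List V} (h : IsSwapAt (pivot L) L (pivotSwap L)) :
    pivotSwap (pivotExchange L) = pivotSwap L := by
  rw [pivotSwap, pivot_pivotExchange, pivotExchange, h.isSwapAt_exchange, ← pivotSwap]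

theorem pivotExchange_pivotExchange {L : ι → List V} (h : IsSwapAt (pivot L) L (pivotSwap L)) :
    pivotExchange (pivotExchange L) = L := by
  rw [pivotExchange, pivot_pivotExchange, pivotSwap_pivotExchange h]
  exact h.exchange_exchange

end Exchange

section LindstromGesselViennot

variable {ι V R : Type*}

/-- The finite sets `P u v` behave like the sets of paths from `u` to `v` of an acyclic directed
graph: no path repeats a vertex, and the tails of two paths may be exchanged at a common vertex. -/
structure IsPathSystem [DecidableEq V] (P : V → V → Finset (List V)) : Prop where
  nodup : ∀ {u v : V} {l : List V}, l ∈ P u v → l.Nodup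
  cut_mem : ∀ {u v u' v' p : V} {l l' : List V}, l ∈ P u v → l' ∈ P u' v' → p ∈ l → p ∈ l' →
    cut p l l' ∈ P u v'

variable [Fintype ι] [DecidableEq ι]

/-- The families of paths from the vertices `s i` to the vertices `t (σ i)`, for all permutations
`σ`. -/
def pathFamilies (P : V → V → Finset (List V)) (s t : ι → V) :
    Finset (Σ _ : Equiv.Perm ι, ι → List V) :=
  Finset.univ.sigma fun σ => Fintype.piFinset fun i => P (s i) (t (σ i))

theorem mem_pathFamilies {P : V → V → Finset (List V)} {s t : ι → V}
    {x : Σ _ : Equiv.Perm ι, ι → List V} :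
    x ∈ pathFamilies P s t ↔ ∀ i, x.2 i ∈ P (s i) (t (x.1 i)) := by
  simp [pathFamilies]

theorem det_sum_eq_sum_pathFamilies [CommRing R] (P : V → V → Finset (List V))
    (wt : List V → R) (s t : ι → V) :
    (Matrix.of fun i j => ∑ l ∈ P (s i) (t j), wt l).det =
      ∑ x ∈ pathFamilies P s t, ((Equiv.Perm.sign x.1 : ℤ) : R) * ∏ i, wt (x.2 i) := by
  rw [← Matrix.det_transpose, Matrix.det_apply', pathFamilies, Finset.sum_sigma]
  refine Finset.sum_congr rfl fun σ _ => ?_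
  dsimp only
  rw [← Finset.mul_sum, ← Finset.prod_univ_sum]
  rfl

variable [DecidableEq V]

/-- The sign-reversing map of the Lindström–Gessel–Viennot lemma. -/
def signedExchange [Nonempty V] (x : Σ _ : Equiv.Perm ι, ι → List V) :
    Σ _ : Equiv.Perm ι, ι → List V :=
  ⟨x.1 * pivotSwap x.2, pivotExchange x.2⟩

section SignedExchange

variable [Nonempty V] {x : Σ _ : Equiv.Perm ι, ι → List V}

theorem signedExchange_mem {P : V → V → Finset (List V)} (hP : IsPathSystem P) {s t : ι → V}
    (hx : x ∈ pathFamilies P s t) (h : IsSwapAt (pivot x.2) x.2 (pivotSwap x.2)) :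
    signedExchange x ∈ pathFamilies P s t := by
  rw [mem_pathFamilies] at hx ⊢
  intro i
  simp only [signedExchange, pivotExchange, exchange, Equiv.Perm.mul_apply]
  rcases h.apply_eq_or_mem i with hi | ⟨hi, hi'⟩
  · rw [hi, cut_self]
    exact hx i
  · exact hP.cut_mem (hx i) (hx _) hi hi'

theorem signedExchange_signedExchange (h : IsSwapAt (pivot x.2) x.2 (pivotSwap x.2)) :
    signedExchange (signedExchange x) = x := by
  simp only [signedExchange, pivotSwap_pivotExchange h, pivotExchange_pivotExchange h, mul_assoc,
    h.mul_self, mul_one]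

theorem signedExchange_ne (h : IsSwapAt (pivot x.2) x.2 (pivotSwap x.2)) :
    signedExchange x ≠ x := by
  intro hfix
  have hswap : x.1 * pivotSwap x.2 = x.1 := congrArg Sigma.fst hfix
  obtain ⟨i, j, hij, -, -, hτ⟩ := h
  rw [mul_eq_left, hτ] at hswap
  exact hij (Equiv.swap_eq_one_iff.1 hswap)

theorem sign_mul_prod_signedExchange [CommRing R] {wt : List V → R}
    (hwt : ∀ a p b, wt (a ++ p :: b) = wt (a ++ [p]) * wt (p :: b))
    (h : IsSwapAt (pivot x.2) x.2 (pivotSwap x.2)) :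
    ((Equiv.Perm.sign (signedExchange x).1 : ℤ) : R) * ∏ i, wt ((signedExchange x).2 i) =
      -(((Equiv.Perm.sign x.1 : ℤ) : R) * ∏ i, wt (x.2 i)) := by
  rw [signedExchange, pivotExchange, h.prod_exchange hwt]
  obtain ⟨i, j, hij, -, -, hτ⟩ := h
  rw [hτ, Equiv.Perm.sign_mul, Equiv.Perm.sign_swap hij]
  simp

end SignedExchange

variable [CommRing R] {P : V → V → Finset (List V)} {wt : List V → R}

open scoped Classical in
theorem sum_intersecting_pathFamilies_eq_zero (hP : IsPathSystem P)
    (hwt : ∀ a p b, wt (a ++ p :: b) = wt (a ++ [p]) * wt (p :: b)) (s t : ι → V) :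
    ∑ x ∈ pathFamilies P s t with Intersecting x.2,
      ((Equiv.Perm.sign x.1 : ℤ) : R) * ∏ i, wt (x.2 i) = 0 := by
  rcases isEmpty_or_nonempty V with hV | hV
  · refine Finset.sum_eq_zero fun x hx => ?_
    obtain ⟨v, -⟩ := (Finset.mem_filter.1 hx).2
    exact hV.elim v
  have hnodup : ∀ x ∈ pathFamilies P s t, ∀ k, (x.2 k).Nodup := fun x hx k =>
    hP.nodup (mem_pathFamilies.1 hx k)
  have hswap : ∀ x ∈ (pathFamilies P s t).filter fun x => Intersecting x.2,
      IsSwapAt (pivot x.2) x.2 (pivotSwap x.2) := fun x hx =>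
    isSwapAt_pivotSwap (hnodup x (Finset.mem_filter.1 hx).1) (Finset.mem_filter.1 hx).2
  refine Finset.sum_involution (fun x _ => signedExchange x) (fun x hx => ?_)
    (fun x hx _ => signedExchange_ne (hswap x hx)) (fun x hx => ?_)
    fun x hx => signedExchange_signedExchange (hswap x hx)
  · rw [sign_mul_prod_signedExchange hwt (hswap x hx), add_neg_cancel]
  · obtain ⟨hpath, hint⟩ := Finset.mem_filter.1 hx
    have hpath' := signedExchange_mem hP hpath (hswap x hx)
    refine Finset.mem_filter.2 ⟨hpath', ?_⟩
    rw [intersecting_iff_exists_two_le_occurrences (hnodup _ hpath)] at hint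
    rw [intersecting_iff_exists_two_le_occurrences (hnodup _ hpath')]
    rwa [signedExchange, pivotExchange, occurrences_exchange]

open scoped Classical in
theorem det_sum_eq_sum_nonintersecting (hP : IsPathSystem P)
    (hwt : ∀ a p b, wt (a ++ p :: b) = wt (a ++ [p]) * wt (p :: b)) (s t : ι → V) :
    (Matrix.of fun i j => ∑ l ∈ P (s i) (t j), wt l).det =
      ∑ x ∈ pathFamilies P s t with ¬ Intersecting x.2,
        ((Equiv.Perm.sign x.1 : ℤ) : R) * ∏ i, wt (x.2 i) := by
  rw [det_sum_eq_sum_pathFamilies, ← Finset.sum_filter_not_add_sum_filter _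
    (fun x => Intersecting x.2), sum_intersecting_pathFamilies_eq_zero hP hwt, add_zero]

open scoped Classical in
theorem det_sum_eq_sum_nonintersecting_of_forall_eq_one (hP : IsPathSystem P)
    (hwt : ∀ a p b, wt (a ++ p :: b) = wt (a ++ [p]) * wt (p :: b)) {s t : ι → V}
    (hst : ∀ x ∈ pathFamilies P s t, ¬ Intersecting x.2 → x.1 = 1) :
    (Matrix.of fun i j => ∑ l ∈ P (s i) (t j), wt l).det =
      ∑ L ∈ Fintype.piFinset fun i => P (s i) (t i) with ¬ Intersecting L, ∏ i, wt (L i) := by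
  rw [det_sum_eq_sum_nonintersecting hP hwt]
  symm
  refine Finset.sum_bij' (fun L _ => ⟨1, L⟩) (fun x _ => x.2) ?_ ?_ (fun _ _ => rfl) ?_ ?_
  · intro L hL
    simpa [mem_pathFamilies] using hL
  · rintro ⟨σ, L⟩ hx
    obtain ⟨hx, hL⟩ := Finset.mem_filter.1 hx
    obtain rfl : σ = 1 := hst _ hx hL
    simpa [hL] using mem_pathFamilies.1 hx
  · rintro ⟨σ, L⟩ hx
    obtain ⟨hx, hL⟩ := Finset.mem_filter.1 hx
    obtain rfl : σ = 1 := hst _ hx hL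
    rfl
  · simp

end LindstromGesselViennot

section Network

variable {K : Type*} [Field K] {n : ℕ}

theorem inDiamond_iff {p : ℤ × ℤ} : InDiamond n p ↔ (p.1 + p.2) % 2 = 0 ∧ p.1 ≤ p.2 ∧ -p.1 ≤ p.2 ∧
    p.1 + p.2 ≤ 2 * n - 2 ∧ p.2 - p.1 ≤ 2 * n - 2 := by
  unfold InDiamond
  rcases abs_cases p.1 with h1 | h1 <;> rcases abs_cases (p.2 - n + 1) with h2 | h2 <;> omega

theorem Edge.fst_lt {p q : ℤ × ℤ} (h : Edge n p q) : p.1 < q.1 := by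
  obtain ⟨-, -, ⟨rfl, -⟩ | rfl | ⟨rfl, -⟩⟩ := h <;> dsimp only <;> omega

theorem Edge.fst_add_snd_le {p q : ℤ × ℤ} (h : Edge n p q) : p.1 + p.2 ≤ q.1 + q.2 := by
  obtain ⟨-, -, ⟨rfl, -⟩ | rfl | ⟨rfl, -⟩⟩ := h <;> dsimp only <;> omega

section IsPath

variable {u v q : ℤ × ℤ} {l : List (ℤ × ℤ)}

theorem IsPath.head_mem (h : IsPath n u v l) : u ∈ l :=
  List.mem_of_head? h.2.2.1

theorem IsPath.last_mem (h : IsPath n u v l) : v ∈ l :=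
  List.mem_of_getLast? h.2.2.2

theorem isPath_iff : IsPath n u v l ↔ (l = [u] ∧ u = v ∧ InDiamond n u) ∨
    ∃ q l', l = u :: l' ∧ Edge n u q ∧ IsPath n q v l' := by
  match l with
  | [] => grind [IsPath]
  | [a] => grind [IsPath]
  | a :: b :: l => grind [IsPath, Edge]

theorem IsPath.le_of_forall_edge_le {φ : ℤ × ℤ → ℤ} (hφ : ∀ p q, Edge n p q → φ p ≤ φ q)
    (h : IsPath n u v l) : φ u ≤ φ v := by
  induction l generalizing u with
  | nil => simpa using h.2.2.1
  | cons a l ih =>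
    rcases isPath_iff.1 h with ⟨-, rfl, -⟩ | ⟨q, l', hl, he, hq⟩
    · exact le_rfl
    · obtain ⟨rfl, rfl⟩ := List.cons_eq_cons.1 hl
      exact (hφ _ _ he).trans (ih hq)

theorem IsPath.fst_le (h : IsPath n u v l) : u.1 ≤ v.1 :=
  h.le_of_forall_edge_le (φ := Prod.fst) fun _ _ he => he.fst_lt.le

theorem IsPath.fst_add_snd_le (h : IsPath n u v l) : u.1 + u.2 ≤ v.1 + v.2 :=
  h.le_of_forall_edge_le (φ := fun p => p.1 + p.2) fun _ _ he => he.fst_add_snd_le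

theorem isPath_self_iff : IsPath n v v l ↔ l = [v] ∧ InDiamond n v := by
  rw [isPath_iff]
  constructor
  · rintro (⟨hl, -, hv⟩ | ⟨q, l', -, he, hq⟩)
    · exact ⟨hl, hv⟩
    · exact absurd hq.fst_le he.fst_lt.not_ge
  · exact fun ⟨hl, hv⟩ => .inl ⟨hl, rfl, hv⟩

theorem IsPath.cut {u' v' p : ℤ × ℤ} {l' : List (ℤ × ℤ)} (h : IsPath n u v l)
    (h' : IsPath n u' v' l') (hp : p ∈ l) (hp' : p ∈ l') : IsPath n u v' (cut p l l') := by
  obtain ⟨a, b, rfl, ha⟩ := List.eq_append_cons_of_mem hp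
  obtain ⟨a', b', rfl, ha'⟩ := List.eq_append_cons_of_mem hp'
  rw [cut_append_cons ha ha']
  obtain ⟨hmem, hchain, hhead, -⟩ := h
  obtain ⟨hmem', hchain', -, hlast'⟩ := h'
  refine ⟨?_, ?_, ?_, ?_⟩
  · intro q hq
    rcases List.mem_append.1 hq with hq | hq
    · exact hmem q (List.mem_append_left _ hq)
    · exact hmem' q (List.mem_append_right _ hq)
  · rw [List.isChain_append] at hchain hchain' ⊢
    exact ⟨hchain.1, hchain'.2.1, by simpa using hchain.2.2⟩
  · cases a <;> simpa using hhead
  · rwa [List.getLast?_append_cons] at hlast' ⊢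

end IsPath

/-- The finite set of the vertex lists of the paths from `u` to `v`. -/
def pathFinset (n : ℕ) (u v : ℤ × ℤ) : Finset (List (ℤ × ℤ)) :=
  (Finset.univ : Finset (Path n u v)).map ⟨fun p => p.1, fun _ _ => Subtype.ext⟩

theorem mem_pathFinset {u v : ℤ × ℤ} {l : List (ℤ × ℤ)} :
    l ∈ pathFinset n u v ↔ IsPath n u v l :=
  Finset.mem_map.trans
    ⟨fun ⟨p, _, hp⟩ => hp ▸ p.2, fun h => ⟨⟨l, h⟩, Finset.mem_univ _, rfl⟩⟩

theorem isPathSystem_pathFinset (n : ℕ) : IsPathSystem (pathFinset n) where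
  nodup h := (mem_pathFinset.1 h).nodup
  cut_mem h h' hp hp' := mem_pathFinset.2 ((mem_pathFinset.1 h).cut (mem_pathFinset.1 h') hp hp')

section NonIntersecting

theorem le_of_disjoint_paths {p p' : ℤ × ℤ} {j j' : ℤ} {l l' : List (ℤ × ℤ)}
    (h : IsPath n p (j, j) l) (h' : IsPath n p' (j', j') l') (hd : l.Disjoint l')
    (hpp' : (-1 ≤ p.1 - p'.1 ∧ p.1 - p'.1 ≤ 2 ∧ p.2 < p'.2) ∨ (p.1 + p.2 = 0 ∧ p'.1 < p.1)) :
    j ≤ j' := by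
  have hp := inDiamond_iff.1 (h.1 _ h.head_mem)
  have hp' := inDiamond_iff.1 (h'.1 _ h'.head_mem)
  -- Always advancing the path that is behind keeps the horizontal distance small enough for the
  -- two paths to be unable to jump over each other.
  induction hN : l.length + l'.length using Nat.strong_induction_on generalizing p p' l l' with
  | _ N ih =>
    by_cases hx : p.1 ≤ p'.1
    · rcases isPath_iff.1 h with ⟨-, rfl, -⟩ | ⟨q, l₁, rfl, ⟨-, hq, hpq⟩, hl₁⟩
      · have := h'.fst_le
        dsimp only at this hx hpp'
        omega
      · have hne : q ≠ p' := fun h0 => hd (List.mem_cons_of_mem _ hl₁.head_mem) (h0 ▸ h'.head_mem)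
        rw [inDiamond_iff] at hq
        refine ih _ ?_ hl₁ h' (List.disjoint_of_disjoint_cons_left hd) ?_ hq hp' rfl
        · simp only [← hN, List.length_cons]
          omega
        · rw [Ne, Prod.ext_iff] at hne
          obtain ⟨rfl, -⟩ | rfl | ⟨rfl, -⟩ := hpq <;> dsimp only at hne hq ⊢ <;> omega
    · rcases isPath_iff.1 h' with ⟨-, rfl, -⟩ | ⟨q, l₁, rfl, ⟨-, hq, hpq⟩, hl₁⟩
      · dsimp only at hp' hx hpp'
        omega
      · have hne : p ≠ q := fun h0 => hd h.head_mem (List.mem_cons_of_mem _ (h0 ▸ hl₁.head_mem))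
        rw [inDiamond_iff] at hq
        refine ih _ ?_ h hl₁ (List.disjoint_of_disjoint_cons_right hd) ?_ hp hq rfl
        · simp only [← hN, List.length_cons]
          omega
        · rw [Ne, Prod.ext_iff] at hne
          obtain ⟨rfl, -⟩ | rfl | ⟨rfl, -⟩ := hpq <;> dsimp only at hne hq ⊢ <;> omega

theorem eq_id_of_disjoint_paths {g : Fin n → Fin n} {L : Fin n → List (ℤ × ℤ)}
    (hL : ∀ i : Fin n, IsPath n (-(i : ℤ), (i : ℤ)) ((g i : ℤ), (g i : ℤ)) (L i))
    (hd : ∀ i i', i ≠ i' → (L i).Disjoint (L i')) : g = id := by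
  have hg : StrictMono g := by
    intro i i' hii'
    refine lt_of_le_of_ne ?_ fun he => ?_
    · have := le_of_disjoint_paths (hL i) (hL i') (hd i i' hii'.ne)
        (.inr ⟨by simp, by simpa using hii'⟩)
      exact_mod_cast this
    · have hlast := (hL i').last_mem
      rw [← he] at hlast
      exact hd i i' hii'.ne (hL i).last_mem hlast
  exact hg.eq_id

theorem NonIntersecting.isPath (f : NonIntersecting n) (i : Fin n) :
    IsPath n (-(i : ℤ), (i : ℤ)) ((i : ℤ), (i : ℤ)) (f.1 i).2.1 := by
  have hend : (fun i => (f.1 i).1) = id := eq_id_of_disjoint_paths (fun i => (f.1 i).2.2) f.2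
  have hpath : ∀ j, (f.1 i).1 = j →
      IsPath n (-(i : ℤ), (i : ℤ)) ((j : ℤ), (j : ℤ)) (f.1 i).2.1 := by
    rintro _ rfl
    exact (f.1 i).2.2
  exact hpath i (congrFun hend i)

theorem NonIntersecting.injective_lists :
    Function.Injective fun (f : NonIntersecting n) i => (f.1 i).2.1 := by
  intro f f' hff'
  refine Subtype.ext (funext fun i => ?_)
  have hlist : (f.1 i).2.1 = (f'.1 i).2.1 := congrFun hff' i
  generalize f.1 i = x at hlist
  generalize f'.1 i = y at hlist
  obtain ⟨j, l, hl⟩ := x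
  obtain ⟨j', l', hl'⟩ := y
  obtain rfl : l = l' := hlist
  obtain rfl : j = j' := by
    have hlast := Option.some_injective _ (hl.2.2.2.symm.trans hl'.2.2.2)
    simpa [Fin.ext_iff] using hlast
  rfl

open scoped Classical in
theorem partitionFunction_eq_sum_pathFinset (A : Matrix (Fin n) (Fin n) K) (lam mu : ℤ → K) :
    partitionFunction A lam mu =
      ∑ L ∈ Fintype.piFinset fun i : Fin n =>
          pathFinset n (-(i : ℤ), (i : ℤ)) ((i : ℤ), (i : ℤ)) with ¬ Intersecting L,
        ∏ i, listWeight A lam mu (L i) := by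
  refine Finset.sum_nbij (fun f i => (f.1 i).2.1) ?_ NonIntersecting.injective_lists.injOn ?_
    fun _ _ => rfl
  · intro f _
    rw [Finset.mem_filter, Fintype.mem_piFinset]
    exact ⟨fun i => mem_pathFinset.2 (f.isPath i), not_intersecting_iff.2 f.2⟩
  · intro L hL
    simp only [Finset.coe_filter, Set.mem_ofPred_eq, Fintype.mem_piFinset, mem_pathFinset,
      not_intersecting_iff] at hL
    exact ⟨⟨fun i => ⟨i, L i, hL.1 i⟩, hL.2⟩, Finset.mem_coe.2 (Finset.mem_univ _), rfl⟩

end NonIntersecting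

section NetworkSum

variable (A : Matrix (Fin n) (Fin n) K) (lam mu : ℤ → K)

theorem listWeight_append_cons (a : List (ℤ × ℤ)) (p : ℤ × ℤ) (b : List (ℤ × ℤ)) :
    listWeight A lam mu (a ++ p :: b) =
      listWeight A lam mu (a ++ [p]) * listWeight A lam mu (p :: b) := by
  induction a with
  | nil => simp [listWeight]
  | cons q a ih =>
    cases a with
    | nil => simp [listWeight]
    | cons q' a => simpa [listWeight, mul_assoc] using congrArg (edgeWeight A lam mu q q' * ·) ih

theorem listWeight_cons {u q v : ℤ × ℤ} {l : List (ℤ × ℤ)} (h : IsPath n q v l) :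
    listWeight A lam mu (u :: l) = edgeWeight A lam mu u q * listWeight A lam mu l := by
  obtain ⟨l', rfl⟩ := List.head?_eq_some_iff.1 h.2.2.1
  rfl

/-- The sum of the weights of the paths from `u` to `v`. -/
def networkSum (u v : ℤ × ℤ) : K :=
  ∑ l ∈ pathFinset n u v, listWeight A lam mu l

theorem sum_path_eq_networkSum (u v : ℤ × ℤ) :
    ∑ p : Path n u v, listWeight A lam mu p.1 = networkSum A lam mu u v := by
  rw [networkSum, pathFinset, Finset.sum_map]
  rfl

theorem networkSum_eq_zero {u v : ℤ × ℤ} (h : ∀ l, ¬ IsPath n u v l) :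
    networkSum A lam mu u v = 0 :=
  Finset.sum_eq_zero fun l hl => absurd (mem_pathFinset.1 hl) (h l)

theorem networkSum_self {v : ℤ × ℤ} (hv : InDiamond n v) : networkSum A lam mu v v = 1 := by
  have hpaths : pathFinset n v v = {[v]} := by
    ext l
    rw [mem_pathFinset, isPath_self_iff, Finset.mem_singleton, and_iff_left hv]
  rw [networkSum, hpaths, Finset.sum_singleton, listWeight]

open scoped Classical in
theorem networkSum_eq_sum_edge {u v : ℤ × ℤ} (huv : u ≠ v) (N : Finset (ℤ × ℤ))
    (hN : ∀ q, Edge n u q → q ∈ N) :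
    networkSum A lam mu u v =
      ∑ q ∈ N with Edge n u q, edgeWeight A lam mu u q * networkSum A lam mu q v := by
  simp only [networkSum, Finset.mul_sum]
  rw [Finset.sum_sigma']
  symm
  refine Finset.sum_nbij (fun x => u :: x.2) ?_ ?_ ?_ ?_
  · rintro ⟨q, l⟩ h
    simp only [Finset.mem_sigma, Finset.mem_filter, mem_pathFinset] at h ⊢
    exact isPath_iff.2 (.inr ⟨q, l, rfl, h.1.2, h.2⟩)
  · rintro ⟨q, l⟩ h ⟨q', l'⟩ h' he
    simp only [Finset.mem_coe, Finset.mem_sigma, Finset.mem_filter, mem_pathFinset] at h h'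
    obtain rfl : l = l' := (List.cons_eq_cons.1 he).2
    obtain rfl : q = q' := Option.some_injective _ (h.2.2.2.1.symm.trans h'.2.2.2.1)
    rfl
  · intro l hl
    rcases isPath_iff.1 (mem_pathFinset.1 hl) with ⟨-, h, -⟩ | ⟨q, l', rfl, he, hp⟩
    · exact absurd h huv
    · refine ⟨⟨q, l'⟩, ?_, rfl⟩
      simp only [Finset.mem_coe, Finset.mem_sigma, Finset.mem_filter, mem_pathFinset]
      exact ⟨⟨hN q he, he⟩, hp⟩
  · rintro ⟨q, l⟩ h
    simp only [Finset.mem_sigma, mem_pathFinset] at h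
    exact (listWeight_cons A lam mu h.2).symm

end NetworkSum

/-- The vertex `(x, y)` with `(x + y) / 2 = u` and `(y - x) / 2 = v`. In these coordinates the
diamond is the square `u, v < n` and the edges are steps of a `StepWeights` network. -/
def site (u v : ℕ) : ℤ × ℤ :=
  ((u : ℤ) - v, (u : ℤ) + v)

theorem site_inj {u v u' v' : ℕ} : site u v = site u' v' ↔ u = u' ∧ v = v' := by
  simp only [site, Prod.mk.injEq]
  omega

theorem inDiamond_site {u v : ℕ} : InDiamond n (site u v) ↔ u < n ∧ v < n := by
  rw [inDiamond_iff]
  simp only [site]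
  omega

theorem site_zero_left (v : ℕ) : site 0 v = (-(v : ℤ), (v : ℤ)) := by
  simp [site]

theorem site_zero_right (u : ℕ) : site u 0 = ((u : ℤ), (u : ℤ)) := by
  simp [site]

theorem site_up (u v : ℕ) : ((site u v).1 + 1, (site u v).2 + 1) = site (u + 1) v := by
  ext <;> simp only [site] <;> push_cast <;> ring

theorem site_horizontal (u v : ℕ) :
    ((site u (v + 1)).1 + 2, (site u (v + 1)).2) = site (u + 1) v := by
  ext <;> simp only [site] <;> push_cast <;> ring

theorem site_down (u v : ℕ) :
    ((site u (v + 1)).1 + 1, (site u (v + 1)).2 - 1) = site u v := by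
  ext <;> simp only [site] <;> push_cast <;> ring

theorem not_edge_site_zero (u : ℕ) (q : ℤ × ℤ) : ¬ Edge n (site u 0) q := by
  rintro ⟨-, hq, hedge⟩
  rw [inDiamond_iff] at hq
  simp only [site] at hedge
  obtain ⟨rfl, h⟩ | rfl | ⟨rfl, -⟩ := hedge <;> dsimp only at hq <;> omega

theorem edge_site_succ_iff {u v : ℕ} (hu : u < n) (hv : v + 1 < n) {q : ℤ × ℤ} :
    Edge n (site u (v + 1)) q ↔
      u + 1 < n ∧ q = site (u + 1) (v + 1) ∨ u + 1 < n ∧ q = site (u + 1) v ∨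
        0 < u ∧ q = site u v := by
  have hup : (site u (v + 1)).1 < (site u (v + 1)).2 := by
    simp only [site]
    omega
  have hdown : -(site u (v + 1)).1 < (site u (v + 1)).2 ↔ 0 < u := by
    simp only [site]
    omega
  rw [Edge, site_up, site_horizontal, site_down, hdown]
  constructor
  · rintro ⟨-, hq, ⟨rfl, -⟩ | rfl | ⟨rfl, h⟩⟩ <;> rw [inDiamond_site] at hq
    · exact .inl ⟨hq.1, rfl⟩
    · exact .inr (.inl ⟨hq.1, rfl⟩)
    · exact .inr (.inr ⟨h, rfl⟩)
  · rintro (⟨h, rfl⟩ | ⟨h, rfl⟩ | ⟨h, rfl⟩) <;> simp only [inDiamond_site]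
    · exact ⟨⟨hu, hv⟩, ⟨h, hv⟩, .inl ⟨trivial, hup⟩⟩
    · exact ⟨⟨hu, hv⟩, ⟨h, by omega⟩, .inr (.inl trivial)⟩
    · exact ⟨⟨hu, hv⟩, ⟨hu, by omega⟩, .inr (.inr ⟨trivial, h⟩)⟩

/-- The label of the vertex `site u v`. -/
def cell (A : Matrix (Fin n) (Fin n) K) (u v : ℕ) : K :=
  entry A (n - v) (u + 1)

theorem label_site (A : Matrix (Fin n) (Fin n) K) (u v : ℕ) : label A (site u v) = cell A u v := by
  simp only [label, site, cell]
  congr 1 <;> omega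

/-- The edge weights of the network in the coordinates of `site`, including weights for the edges
along the two lower borders, which the network lacks. -/
def stepWeights (A : Matrix (Fin n) (Fin n) K) (lam mu : ℤ → K) : StepWeights K where
  h u v := lam (u + v + 1 - n)
  w u v := cell A u (v + 1) / cell A u v
  d u v := mu (u - v) * (cell A u (v + 1) / cell A u v)

section StepWeights

variable (A : Matrix (Fin n) (Fin n) K) (lam mu : ℤ → K)

theorem edgeWeight_site_up (u v : ℕ) :
    edgeWeight A lam mu (site u v) (site (u + 1) v) = (stepWeights A lam mu).h u v := by
  rw [edgeWeight, if_pos (site_up u v).symm]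
  rfl

theorem edgeWeight_site_horizontal (u v : ℕ) :
    edgeWeight A lam mu (site u (v + 1)) (site (u + 1) v) = (stepWeights A lam mu).d u v := by
  have hmu : (site u (v + 1)).1 + 1 = (u : ℤ) - v := by
    simp only [site]
    push_cast
    ring
  rw [edgeWeight, site_up, if_neg (by simp [site_inj]), if_pos (site_horizontal u v).symm,
    site_down, label_site, label_site, hmu]
  rfl

theorem edgeWeight_site_down (u v : ℕ) :
    edgeWeight A lam mu (site u (v + 1)) (site u v) = (stepWeights A lam mu).w u v := by
  rw [edgeWeight, site_up, site_horizontal, site_down, if_neg (by simp [site_inj]),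
    if_neg (by simp [site_inj]), label_site, label_site]
  rfl

theorem networkSum_site_zero_of_ne {u j : ℕ} (huj : u ≠ j) :
    networkSum A lam mu (site u 0) (site j 0) = 0 := by
  refine networkSum_eq_zero A lam mu fun l h => ?_
  rcases isPath_iff.1 h with ⟨-, h, -⟩ | ⟨q, -, -, he, -⟩
  · exact huj (site_inj.1 h).1
  · exact not_edge_site_zero u q he

theorem networkSum_site_of_lt {u v j : ℕ} (hju : j < u) :
    networkSum A lam mu (site u v) (site j 0) = 0 := by
  refine networkSum_eq_zero A lam mu fun l h => ?_
  have := h.fst_add_snd_le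
  simp only [site] at this
  omega

theorem networkSum_site_of_le {u v : ℕ} (hu : n ≤ u) (q : ℤ × ℤ) :
    networkSum A lam mu (site u v) q = 0 :=
  networkSum_eq_zero A lam mu fun _ h => (inDiamond_site.1 (h.1 _ h.head_mem)).1.not_ge hu

theorem networkSum_site_succ {u v : ℕ} (hu : u < n) (hv : v + 1 < n) (j : ℕ) :
    networkSum A lam mu (site u (v + 1)) (site j 0) =
      (stepWeights A lam mu).trim.h u (v + 1) *
          networkSum A lam mu (site (u + 1) (v + 1)) (site j 0) +
        (stepWeights A lam mu).trim.w u v * networkSum A lam mu (site u v) (site j 0) +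
        (stepWeights A lam mu).trim.d u v * networkSum A lam mu (site (u + 1) v) (site j 0) := by
  classical
  rw [networkSum_eq_sum_edge A lam mu (by simp [site_inj])
    {site (u + 1) (v + 1), site u v, site (u + 1) v}
    (fun q hq => by
      rcases (edge_site_succ_iff hu hv).1 hq with ⟨-, rfl⟩ | ⟨-, rfl⟩ | ⟨-, rfl⟩ <;> simp),
    Finset.sum_filter, Finset.sum_insert (by simp [site_inj]),
    Finset.sum_insert (by simp [site_inj]), Finset.sum_singleton, add_assoc]
  simp only [edge_site_succ_iff hu hv, site_inj, edgeWeight_site_up, edgeWeight_site_horizontal,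
    edgeWeight_site_down, StepWeights.trim, StepWeights.trimLeft, StepWeights.trimBottom]
  have hzero := fun v' (h : ¬ u + 1 < n) =>
    networkSum_site_of_le A lam mu (v := v') (not_lt.1 h) (site j 0)
  congr 1
  · by_cases h : u + 1 < n <;> simp [h, hzero]
  congr 1
  · by_cases h : u = 0 <;> simp [h, Nat.pos_iff_ne_zero]
  · by_cases h : u + 1 < n <;> simp [h, hzero]

theorem networkSum_site_eq_pathSum (a v : ℕ) {u : ℕ} (hu : u + a < n) (hv : v < n) :
    networkSum A lam mu (site u v) (site (u + a) 0) =
      ((stepWeights A lam mu).trim.shift u 0).pathSum a v := by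
  induction v generalizing a u with
  | zero =>
    cases a with
    | zero =>
      rw [add_zero] at hu ⊢
      rw [StepWeights.pathSum_zero_zero,
        networkSum_self A lam mu (inDiamond_site.2 ⟨hu, hv⟩)]
    | succ a =>
      rw [StepWeights.pathSum_succ_zero, networkSum_site_zero_of_ne A lam mu (by omega)]
      simp [StepWeights.trim]
  | succ v ihv =>
    induction a generalizing u with
    | zero =>
      rw [networkSum_site_succ A lam mu (by omega) hv, ihv 0 hu (by omega),
        networkSum_site_of_lt A lam mu (by omega), networkSum_site_of_lt A lam mu (by omega),
        StepWeights.pathSum_zero_succ]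
      simp
    | succ a iha =>
      have hstep := iha (u := u + 1) (by omega)
      have hdiag := ihv a (u := u + 1) (by omega) (by omega)
      rw [add_right_comm] at hstep hdiag
      rw [networkSum_site_succ A lam mu (by omega) hv, ihv (a + 1) hu (by omega),
        StepWeights.pathSum_succ_succ, StepWeights.shift_shift]
      rw [← add_assoc, hstep, hdiag]
      simp

theorem det_networkSum_eq_pathDet :
    (Matrix.of fun i j : Fin n =>
      networkSum A lam mu (-(i : ℤ), (i : ℤ)) ((j : ℤ), (j : ℤ))).det =
      (stepWeights A lam mu).pathDet n := by
  rw [← StepWeights.pathDet_trim]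
  refine congrArg Matrix.det (Matrix.ext fun i j => ?_)
  have h := networkSum_site_eq_pathSum A lam mu j i (u := 0) (by omega) i.2
  rwa [zero_add, site_zero_left, site_zero_right, StepWeights.shift_zero_zero] at h

theorem partitionFunction_eq_pathDet :
    partitionFunction A lam mu = (stepWeights A lam mu).pathDet n := by
  rw [partitionFunction_eq_sum_pathFinset, ← det_networkSum_eq_pathDet]
  refine (det_sum_eq_sum_nonintersecting_of_forall_eq_one (isPathSystem_pathFinset n)
    (listWeight_append_cons A lam mu) fun x hx hdisjoint => ?_).symm
  have hpath := fun i => mem_pathFinset.1 (mem_pathFamilies.1 hx i)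
  exact Equiv.ext (congrFun (eq_id_of_disjoint_paths hpath (not_intersecting_iff.1 hdisjoint)))

theorem leftVertex_of_lt {i : ℕ} (hi : i < n) : leftVertex n i = (-(i : ℤ), (i : ℤ)) := by
  rw [leftVertex, abs_of_nonpos (by omega)]
  congr 1
  ring

theorem rightVertex_of_lt {i : ℕ} (hi : i < n) : rightVertex n i = ((i : ℤ), (i : ℤ)) := by
  rw [rightVertex, abs_of_nonpos (by omega)]
  congr 1
  ring

theorem aHat_eq_pathDet : aHat A lam mu = (stepWeights A lam mu).pathDet n := by
  rw [aHat, ← det_networkSum_eq_pathDet]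
  refine congrArg Matrix.det (Matrix.ext fun i j => ?_)
  have h := sum_path_eq_networkSum A lam mu (leftVertex n (i : ℕ)) (rightVertex n (j : ℕ))
  refine h.trans ?_
  rw [leftVertex_of_lt i.2, rightVertex_of_lt j.2, Matrix.of_apply]

end StepWeights

end Network

section TSystem

variable {K : Type*} [Field K] {n : ℕ} {A : Matrix (Fin n) (Fin n) K} {lam mu : ℤ → K}

variable (A lam mu) in
/-- The solution of the `T`-system at level `k`, indexed by the lower left corner `cell A u v` of
the `k × k` block of consecutive rows and columns of `A` on which it depends. -/
def blockT (k u v : ℕ) : K :=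
  T A lam mu k (u + v + k - n) (u - v)

theorem blockT_ne_zero (hdef : IsDefined A lam mu) {k u v : ℕ} (hu : u + k + 2 ≤ n)
    (hv : v + k + 2 ≤ n) : blockT A lam mu k (u + 1) (v + 1) ≠ 0 := by
  refine hdef k _ _ (by push_cast; omega) ?_
  rcases abs_cases (((u + 1 : ℕ) : ℤ) + (v + 1 : ℕ) + k - n) with ⟨h, -⟩ | ⟨h, -⟩ <;>
    rcases abs_cases (((u + 1 : ℕ) : ℤ) - (v + 1 : ℕ)) with ⟨h', -⟩ | ⟨h', -⟩ <;>
    rw [h, h'] <;> omega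

theorem blockT_add_two_mul {k u v : ℕ} (hne : blockT A lam mu k (u + 1) (v + 1) ≠ 0) :
    blockT A lam mu (k + 2) u v * blockT A lam mu k (u + 1) (v + 1) =
      mu (u - v) * blockT A lam mu (k + 1) (u + 1) v * blockT A lam mu (k + 1) u (v + 1) +
        lam (u + v + k + 2 - n) * blockT A lam mu (k + 1) (u + 1) (v + 1) *
          blockT A lam mu (k + 1) u v := by
  rw [← eq_div_iff hne]
  simp only [blockT, T]
  push_cast
  ring_nf

theorem cell_ne_zero (hA : ∀ i j : Fin n, 0 < (i : ℕ) → A i j ≠ 0) {u v : ℕ} (hu : u < n)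
    (hv : v + 1 < n) : cell A u v ≠ 0 := by
  rw [cell, entry, dif_pos (by omega)]
  exact hA _ _ (by simp only; omega)

variable (A lam mu) in
/-- The path determinant of the network shifted to `(u, v)`, multiplied by the bottom row of the
`k × k` block of `A` with lower left corner `cell A u v`. -/
def blockPathDet (k u v : ℕ) : K :=
  ((stepWeights A lam mu).shift u v).pathDet k * ∏ i ∈ Finset.range k, cell A (u + i) v

theorem blockPathDet_zero (u v : ℕ) : blockPathDet A lam mu 0 u v = 1 := by
  rw [blockPathDet, StepWeights.pathDet_zero, Finset.prod_range_zero, one_mul]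

theorem blockPathDet_one (u v : ℕ) : blockPathDet A lam mu 1 u v = cell A u v := by
  rw [blockPathDet, StepWeights.pathDet_one, Finset.prod_range_one, one_mul, add_zero]

theorem prod_cell_succ_left (k u v : ℕ) :
    ∏ i ∈ Finset.range (k + 1), cell A (u + i) v =
      cell A u v * ∏ i ∈ Finset.range k, cell A (u + 1 + i) v := by
  rw [Finset.prod_range_succ', mul_comm]
  simp only [add_zero, add_assoc, add_comm 1]

theorem prod_cell_succ_right (k u v : ℕ) :
    ∏ i ∈ Finset.range (k + 1), cell A (u + 1 + i) v =
      (∏ i ∈ Finset.range k, cell A (u + 1 + i) v) * cell A (u + k + 1) v := by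
  rw [Finset.prod_range_succ, add_right_comm]

theorem blockPathDet_add_two_mul {k u v : ℕ} (hleft : cell A u v ≠ 0)
    (hright : cell A (u + k + 1) v ≠ 0) :
    blockPathDet A lam mu (k + 2) u v * blockPathDet A lam mu k (u + 1) (v + 1) =
      mu (u - v) * blockPathDet A lam mu (k + 1) (u + 1) v *
          blockPathDet A lam mu (k + 1) u (v + 1) +
        lam (u + v + k + 2 - n) * blockPathDet A lam mu (k + 1) (u + 1) (v + 1) *
          blockPathDet A lam mu (k + 1) u v := by
  have hcondense := ((stepWeights A lam mu).shift u v).pathDet_condensation k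
  have hh : ((stepWeights A lam mu).shift u v).h 0 (k + 1) = lam (u + v + k + 2 - n) := by
    simp only [StepWeights.shift, stepWeights]
    congr 1
    push_cast
    ring
  have hw : ((stepWeights A lam mu).shift u v).w (k + 1) 0 =
      cell A (u + k + 1) (v + 1) / cell A (u + k + 1) v := rfl
  have hd : ((stepWeights A lam mu).shift u v).d 0 0 =
      mu (u - v) * (cell A u (v + 1) / cell A u v) := rfl
  simp only [StepWeights.shift_shift, add_zero, hh, hw, hd] at hcondense
  field_simp at hcondense
  simp only [blockPathDet]
  rw [prod_cell_succ_left (k + 1) u v, prod_cell_succ_left k u (v + 1),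
    prod_cell_succ_left k u v, prod_cell_succ_right, prod_cell_succ_right]
  linear_combination (∏ i ∈ Finset.range k, cell A (u + 1 + i) v) *
    (∏ i ∈ Finset.range k, cell A (u + 1 + i) (v + 1)) * hcondense

theorem blockT_eq_blockPathDet (hdef : IsDefined A lam mu)
    (hA : ∀ i j : Fin n, 0 < (i : ℕ) → A i j ≠ 0) (k u v : ℕ) (hu : u + k ≤ n) (hv : v + k ≤ n) :
    blockT A lam mu k u v = blockPathDet A lam mu k u v := by
  induction k using Nat.twoStepInduction generalizing u v with
  | zero => rw [blockPathDet_zero, blockT, T]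
  | one =>
    rw [blockPathDet_one, blockT, T, cell]
    congr 1 <;> push_cast <;> omega
  | more k ih ih' =>
    have hne := blockT_ne_zero hdef hu hv
    have hrec := blockT_add_two_mul hne
    rw [ih _ _ (by omega) (by omega)] at hne
    rw [ih _ _ (by omega) (by omega), ih' _ _ (by omega) (by omega), ih' _ _ (by omega) (by omega),
      ih' _ _ (by omega) (by omega), ih' _ _ (by omega) (by omega),
      ← blockPathDet_add_two_mul (cell_ne_zero hA (by omega) (by omega))
        (cell_ne_zero hA (by omega) (by omega))] at hrec
    exact mul_right_cancel₀ hne hrec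

theorem lambdaDet_eq_pathDet_mul_prod (hdef : IsDefined A lam mu)
    (hA : ∀ i j : Fin n, 0 < (i : ℕ) → A i j ≠ 0) :
    lambdaDet A lam mu =
      (stepWeights A lam mu).pathDet n * ∏ j : Fin n, entry A n ((j : ℕ) + 1) := by
  have h := blockT_eq_blockPathDet hdef hA n 0 0 (by omega) (by omega)
  rw [blockT, blockPathDet, StepWeights.shift_zero_zero, Finset.prod_range] at h
  simpa [lambdaDet, cell] using h

end TSystem

end LambdaDet

end

theorem mainTheorem6 {K : Type*} [Field K] (n : ℕ) (A : Matrix (Fin n) (Fin n) K)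
    (lam mu : ℤ → K)
    (hdef : LambdaDet.IsDefined A lam mu)
    (hA : ∀ i j : Fin n, 0 < (i : ℕ) → A i j ≠ 0) :
    LambdaDet.lambdaDet A lam mu =
        LambdaDet.aHat A lam mu * ∏ j : Fin n, LambdaDet.entry A n ((j : ℕ) + 1) ∧
      LambdaDet.lambdaDet A lam mu =
        LambdaDet.partitionFunction A lam mu *
          ∏ j : Fin n, LambdaDet.entry A n ((j : ℕ) + 1) := by
  have h := LambdaDet.lambdaDet_eq_pathDet_mul_prod hdef hA
  exact ⟨by rw [LambdaDet.aHat_eq_pathDet, h], by rw [LambdaDet.partitionFunction_eq_pathDet, h]⟩
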